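/- Let $2 \le k < d$ and let $\Sigma \subset \mathbb{R}^d$ be a bounded smooth embedded $k$-manifold without boundary (that is, a compact $C^\infty$ submanifold). The medial axis $M$ of $\Sigma$ is the closure of the set of points of $\mathbb{R}^d$ that have more than one nearest point on $\Sigma$, and the local feature size of $p \in \Sigma$ is $\mathrm{lfs}(p) = \min_{m \in M} |pm|$. For $p \in \Sigma$, the normal space $N_p\Sigma$ is the $(d-k)$-flat through $p$ orthogonal to the tangent space of $\Sigma$ at $p$. For a (nondegenerate) triangle $\tau \subset \mathbb{R}^d$, $N_\tau$ is the $(d-2)$-flat of all points equidistant from the three vertices of $\tau$. For flats $F, G$ with $\dim F \le \dim G$, the angle between them is $\angle(F,G) = \angle(G,F) = \max_{\ell_F \subset F} \min_{\ell_G \subset G} \angle(\ell_F, \ell_G) \in [0^\circ, 90^\circ]$, where $\ell_F$ and $\ell_G$ range over lines. Let $$\eta(\delta) = \arccos\left(1 - \frac{\delta^2}{2\sqrt{1-\delta^2}}\right) \text{ if } d-k = 1, \qquad \eta(\delta) = \arccos\sqrt{1 - \frac{\delta^2}{\sqrt{1-\delta^2}}} \text{ if } d - k \ge 2.$$ Let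 $\tau = \triangle vv'v''$ be a triangle whose vertices lie on $\Sigma$, let $u$ be a point in $\Sigma \cap N_\tau$, let $s = |vu| = |v'u| = |v''u|$, and suppose that $s \le \varepsilon\,\mathrm{lfs}(u)$ for some $\varepsilon \le 1/3$. Let $x$ be any point on $\tau$ (including its interior and boundary) and let $\tilde{x}$ be the point nearest $x$ on $\Sigma$. Then for every angle $\phi \in (0^\circ, 60^\circ]$, $$\angle(N_\tau, N_{\tilde{x}}\Sigma) \le \max\left\{ \eta\left(\frac{\varepsilon}{1-\varepsilon}\right) + \arcsin\left(\frac{\varepsilon}{1-\varepsilon}\cot\frac{\phi}{2}\right),\; 2\eta(\varepsilon) + \arcsin\left(\frac{\varepsilon}{1-\varepsilon}\cot\left(45^\circ - \frac{\phi}{4}\right)\right)\right\},$$ where $\arcsin t$ is read as $90^\circ$ for $t > 1$ (so that the bound is then trivial). -/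

import Mathlib

open scoped ContDiff

noncomputable section

namespace SurfaceApprox

variable {E : Type*} [NormedAddCommGroup E] [InnerProductSpace ℝ E]

/-- `S` is a smooth (`C^∞`) embedded `k`-dimensional submanifold, without boundary, of `E`:
around each of its points there is a smooth diffeomorphism between open subsets of `E` that
straightens `S` to a `k`-dimensional linear subspace. -/
def IsSmoothSubmanifold (k : ℕ) (S : Set E) : Prop :=
  ∀ p ∈ S, ∃ (Φ : OpenPartialHomeomorph E E) (L : Submodule ℝ E),
    p ∈ Φ.source ∧ ContDiffOn ℝ ∞ Φ Φ.source ∧ ContDiffOn ℝ ∞ Φ.symm Φ.target ∧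
      Module.finrank ℝ L = k ∧ ∀ x ∈ Φ.source, x ∈ S ↔ Φ x ∈ L

/-- The direction of the tangent space `T_p S`: the linear span of the limits of secant
directions of `S` at `p`. -/
def tangentDirection (S : Set E) (p : E) : Submodule ℝ E :=
  Submodule.span ℝ (tangentConeAt ℝ S p)

/-- The normal space `N_p S`: the flat through `p` that is orthogonal and complementary to
the tangent space. -/
def normalSpace (S : Set E) (p : E) : AffineSubspace ℝ E :=
  AffineSubspace.mk' p (tangentDirection S p)ᗮ

/-- `y` is a point of `S` nearest to `x`. -/
def IsNearestPoint (S : Set E) (x y : E) : Prop :=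
  y ∈ S ∧ ∀ z ∈ S, dist x y ≤ dist x z

/-- The medial axis: the closure of the set of all points that have
more than one nearest point on `S`. -/
def medialAxis (S : Set E) : Set E :=
  closure {w | ∃ a b, a ≠ b ∧ IsNearestPoint S w a ∧ IsNearestPoint S w b}

/-- The local feature size: the distance from `p` to the medial axis. -/
def lfs (S : Set E) (p : E) : ℝ :=
  Metric.infDist p (medialAxis S)

/-- The normal space `N_τ` of a simplex: the flat of all points equidistant to
all the vertices. -/
def simplexNormalSpace {n : ℕ} (τ : Affine.Simplex ℝ E n) : AffineSubspace ℝ E :=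
  ⨅ (i) (j), AffineSubspace.perpBisector (τ.points i) (τ.points j)

theorem mem_simplexNormalSpace {n : ℕ} (τ : Affine.Simplex ℝ E n) (u : E) :
    u ∈ simplexNormalSpace τ ↔ ∀ i j, dist u (τ.points i) = dist u (τ.points j) := by
  simp [simplexNormalSpace, AffineSubspace.mem_iInf_iff,
    AffineSubspace.mem_perpBisector_iff_dist_eq]

/-- The angle in `[0, π / 2]` between the (undirected) lines spanned by
the nonzero vectors `u` and `v`. -/
def lineAngle (u v : E) : ℝ :=
  Real.arccos (|inner ℝ u v| / (‖u‖ * ‖v‖))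

/-- `max` over the lines in `F` of `min` over the lines in `G` of the angle between them. -/
def maxMinAngle (F G : Submodule ℝ E) : ℝ :=
  ⨆ u : {u : E // u ∈ F ∧ u ≠ 0}, ⨅ v : {v : E // v ∈ G ∧ v ≠ 0}, lineAngle u.1 v.1

/-- The angle between two flats; the maximum is over the lines in the flat of lower
dimension, the minimum over the lines in the flat of higher dimension. -/
def flatAngle (F G : AffineSubspace ℝ E) : ℝ :=
  if Module.finrank ℝ F.direction ≤ Module.finrank ℝ G.direction then
    maxMinAngle F.direction G.direction
  else
    maxMinAngle G.direction F.direction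

/-- The normal variation bound in codimension 1. -/
def eta1 (δ : ℝ) : ℝ :=
  Real.arccos (1 - δ ^ 2 / (2 * √(1 - δ ^ 2)))

/-- The normal variation bound in codimension 2 and higher. -/
def eta2 (δ : ℝ) : ℝ :=
  Real.arccos √(1 - δ ^ 2 / √(1 - δ ^ 2))

/-- The normal variation bound in codimension `c ≥ 1`. -/
def eta (c : ℕ) (δ : ℝ) : ℝ :=
  if c = 1 then eta1 δ else eta2 δ

end SurfaceApprox

end

open Set Metric Filter Topology
open scoped ContDiff

/-! Angles between linear subspaces obey a triangle inequality, so the bound is a chain of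
comparisons from the normal space at `x'` to one at a vertex of `τ`, and from there to `N_τ`. Since
`d - k ≤ d - 2`, it suffices to follow lines of the normal space at `x'`.

Some vertex is within `s` of `x'`, for otherwise `x` would lie strictly nearer to `u` than to `x'`.
If the plane angle there is at least `φ`, the chain goes straight through that vertex, where the
local feature size is at least `(1 - ε) lfs u`. Otherwise one of the other two angles is at least
`90° - φ/2`. Then the chain passes through `u`, whose distance to `x'` and to every vertex is at
most `s`, and each of these two links costs `η(ε)`.

The last link (`angleLE_triangle`): a vertex's empty tangent balls force each unit normal there to
be nearly orthogonal to both sides of `τ` at that vertex. A Gram determinant computation and the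
fact that the circumradius is at most `s` then bound the projection of the normal to the plane of
`τ`.

The other links (`angleLE_normal`) are the normal variation bound. Let `q` be near `p` and `n` a
unit normal at `q`. The line through `q` along `n` leaves a ball of radius `ρ < lfs p` about `p` at
two points, and the balls about these points through `q` contain no point of the manifold. Each of
them must miss some ball of radius `ρ` tangent at `p`: otherwise a disc bounded by the centers of
these tangent balls would avoid the manifold, which a form of Brouwer's theorem forbids
(`exists_disjoint_tangent_ball`). In codimension one, orientation pairs the balls on opposite sides,
by the intermediate value theorem (`exists_disjoint_opposite_balls`), and the estimate is sharper.
Disjointness becomes two quadratic inequalities, which combine by the power of the point `q`. -/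

namespace SurfaceApprox

/-! ### No-retraction theorem, by the change of variables formula -/

section Brouwer

open MeasureTheory
open scoped Manifold NNReal

variable {F : Type*} [NormedAddCommGroup F] [InnerProductSpace ℝ F] [FiniteDimensional ℝ F]

/-- Evaluation at `1` of the polynomial `t ↦ det (1 + t A)` is a fixed linear combination of its
values at any `finrank + 1` distinct nodes. -/
theorem det_one_add_eq_sum_lagrange (v : ℕ → ℝ) (hv : Function.Injective v) (A : F →L[ℝ] F) :
    (ContinuousLinearMap.id ℝ F + A).det =
      ∑ i ∈ Finset.range (Module.finrank ℝ F + 1),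
        (Lagrange.basis (Finset.range (Module.finrank ℝ F + 1)) v i).eval 1 *
          (ContinuousLinearMap.id ℝ F + v i • A).det := by
  classical
  set b := Module.finBasis ℝ F
  set M := LinearMap.toMatrix b b (A : F →ₗ[ℝ] F)
  set P : Polynomial ℝ :=
    ((Polynomial.X : Polynomial ℝ) • M.map ⇑(Polynomial.C (R := ℝ)) +
      (1 : Matrix (Fin (Module.finrank ℝ F)) (Fin (Module.finrank ℝ F)) ℝ).map
      ⇑(Polynomial.C (R := ℝ))).det
  have hP : ∀ t : ℝ, P.eval t = (ContinuousLinearMap.id ℝ F + t • A).det := by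
    intro t
    have h1 : (ContinuousLinearMap.id ℝ F + t • A).det = (1 + t • M).det := by
      rw [ContinuousLinearMap.det, ← LinearMap.det_toMatrix b]
      congr 1
      simp [M]
    rw [h1, ← Polynomial.coe_evalRingHom, RingHom.map_det]
    congr 1
    ext i j
    simp [Matrix.one_apply, add_comm]
    split_ifs <;> simp [mul_comm]
  have hdeg : P.degree < ((Finset.range (Module.finrank ℝ F + 1)).card : WithBot ℕ) := by
    have h := Polynomial.natDegree_det_X_add_C_le M 1
    refine lt_of_le_of_lt Polynomial.degree_le_natDegree ?_
    rw [Finset.card_range]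
    have : P.natDegree < Module.finrank ℝ F + 1 := by
      simpa [P, Nat.lt_succ_iff] using h
    exact_mod_cast this
  have h := Lagrange.eq_interpolate (s := Finset.range (Module.finrank ℝ F + 1)) (v := v)
    (f := P) hv.injOn hdeg
  have h1 : (ContinuousLinearMap.id ℝ F + A).det = P.eval 1 := by rw [hP, one_smul]
  rw [h1]
  conv_lhs => rw [h]
  rw [Lagrange.interpolate_apply, Polynomial.eval_finsetSum]
  refine Finset.sum_congr rfl fun i _ ↦ ?_
  rw [Polynomial.eval_mul, Polynomial.eval_C, hP, mul_comm]

theorem sum_eval_lagrange_basis_range (n : ℕ) (v : ℕ → ℝ) (hv : Function.Injective v) :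
    ∑ i ∈ Finset.range (n + 1), (Lagrange.basis (Finset.range (n + 1)) v i).eval 1 = 1 := by
  rw [← Polynomial.eval_finsetSum, Lagrange.sum_basis hv.injOn (by simp), Polynomial.eval_one]

/-- The straight-line homotopy from the identity towards a self-map of a ball that fixes the sphere
maps the open ball onto itself for small times. -/
theorem image_ball_homotopy {R : ℝ} (r : F → F) (hr : ContinuousOn r (closedBall 0 R))
    (hrR : ∀ x ∈ closedBall (0 : F) R, ‖r x‖ ≤ R) (hfix : ∀ x ∈ sphere (0 : F) R, r x = x)
    (hR : 0 < R) {C : ℝ≥0} (hC : LipschitzOnWith C (fun x ↦ r x - x) (closedBall 0 R))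
    {t : ℝ} (ht : 0 < t) (ht1 : t < 1) (htC : t * C < 1 / 2) :
    (fun x ↦ x + t • (r x - x)) '' ball 0 R = ball 0 R ∧
      InjOn (fun x ↦ x + t • (r x - x)) (ball 0 R) := by
  set f : F → F := fun x ↦ x + t • (r x - x)
  have hmaps : ∀ x ∈ ball (0 : F) R, f x ∈ ball (0 : F) R := by
    intro x hx
    have h1 : f x = (1 - t) • x + t • r x := by simp only [f]; module
    rw [mem_ball_zero_iff] at hx ⊢
    rw [h1]
    calc ‖(1 - t) • x + t • r x‖ ≤ (1 - t) * ‖x‖ + t * ‖r x‖ := by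
          refine (norm_add_le _ _).trans_eq ?_
          rw [norm_smul, norm_smul, Real.norm_of_nonneg (by linarith), Real.norm_of_nonneg ht.le]
      _ < (1 - t) * R + t * R := by
          have := hrR x (mem_closedBall_zero_iff.2 hx.le)
          have h2 : (1 - t) * ‖x‖ < (1 - t) * R := mul_lt_mul_of_pos_left hx (by linarith)
          have h3 : t * ‖r x‖ ≤ t * R := mul_le_mul_of_nonneg_left this ht.le
          linarith
      _ = R := by ring
  -- The perturbation of the identity has Lipschitz constant `t * C < 1 / 2`, so `f` is injective
  -- and open on the ball.
  have happ : ApproximatesLinearOn f (ContinuousLinearEquiv.refl ℝ F : F →L[ℝ] F) (ball 0 R)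
      (1 / 2) := by
    intro x hx y hy
    have h1 : f x - f y - (ContinuousLinearEquiv.refl ℝ F : F →L[ℝ] F) (x - y) =
        t • ((r x - x) - (r y - y)) := by simp only [f]; simp; module
    rw [h1, norm_smul, Real.norm_of_nonneg ht.le]
    have h2 := hC.dist_le_mul x (ball_subset_closedBall hx) y (ball_subset_closedBall hy)
    rw [dist_eq_norm, dist_eq_norm] at h2
    calc t * ‖r x - x - (r y - y)‖ ≤ t * (C * ‖x - y‖) := by gcongr
      _ = (t * C) * ‖x - y‖ := by ring
      _ ≤ _ := by
        refine mul_le_mul_of_nonneg_right ?_ (norm_nonneg _)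
        push_cast
        exact htC.le
  have hhalf : Subsingleton F ∨
      (1 / 2 : ℝ≥0) < ‖((ContinuousLinearEquiv.refl ℝ F).symm : F →L[ℝ] F)‖₊⁻¹ := by
    rcases subsingleton_or_nontrivial F with h | h
    · exact Or.inl h
    · right
      have : ((ContinuousLinearEquiv.refl ℝ F).symm : F →L[ℝ] F) =
        ContinuousLinearMap.id ℝ F := rfl
      rw [this, ContinuousLinearMap.nnnorm_id, inv_one]
      rw [← NNReal.coe_lt_coe]; push_cast; norm_num
  have hopen : IsOpen (f '' ball 0 R) :=
    happ.open_image (ContinuousLinearEquiv.refl ℝ F).toNonlinearRightInverse isOpen_ball hhalf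
  refine ⟨?_, happ.injOn hhalf⟩
  refine Subset.antisymm (image_subset_iff.2 hmaps) ?_
  -- The image is also closed relative to the open ball: a limit point is the image of a point of
  -- the closed ball, and points of the sphere are fixed, hence excluded.
  refine (convex_ball (0 : F) R).isPreconnected.subset_of_closure_inter_subset hopen ?_ ?_
  · exact ⟨f 0, hmaps 0 (mem_ball_self hR), mem_image_of_mem _ (mem_ball_self hR)⟩
  · have hcont : ContinuousOn f (closedBall 0 R) :=
      continuousOn_id.add ((hr.sub continuousOn_id).const_smul t)
    have hcl : IsClosed (f '' closedBall 0 R) :=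
      ((isCompact_closedBall (0 : F) R).image_of_continuousOn hcont).isClosed
    rintro y ⟨hy, hyR⟩
    obtain ⟨x, hx, rfl⟩ : y ∈ f '' closedBall 0 R :=
      closure_minimal (image_mono ball_subset_closedBall) hcl hy
    rcases (mem_closedBall_zero_iff.1 hx).lt_or_eq with h | h
    · exact mem_image_of_mem _ (mem_ball_zero_iff.2 h)
    · exfalso
      have : f x = x := by
        simp [f, hfix x (mem_sphere_zero_iff_norm.2 h)]
      rw [this, mem_ball_zero_iff] at hyR
      exact hyR.ne h

/-- There is no smooth retraction of a ball onto its boundary sphere. -/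
theorem not_exists_smooth_retraction {R : ℝ} (hR : 0 < R) (r : F → F) (hr : ContDiff ℝ 1 r)
    (hrR : ∀ x, ‖r x‖ = R) (hfix : ∀ x ∈ sphere (0 : F) R, r x = x) : False := by
  let _ : MeasurableSpace F := borel F
  have _ : BorelSpace F := ⟨rfl⟩
  set μ : Measure F := MeasureTheory.Measure.addHaar
  have hd : ∀ x, HasFDerivAt r (fderiv ℝ r x) x := fun x ↦
    (hr.differentiable one_ne_zero x).hasFDerivAt
  set k : F → F →L[ℝ] F := fun x ↦ fderiv ℝ r x - ContinuousLinearMap.id ℝ F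
  have hkc : Continuous k := (hr.continuous_fderiv one_ne_zero).sub continuous_const
  have hkd : ∀ x, HasFDerivAt (fun x ↦ r x - x) (k x) x := fun x ↦ (hd x).sub (hasFDerivAt_id x)
  obtain ⟨C, hCpos, hCb⟩ : ∃ C : ℝ, 0 < C ∧ ∀ x ∈ closedBall (0 : F) R, ‖k x‖ ≤ C := by
    obtain ⟨C, hC⟩ := (isCompact_closedBall (0 : F) R).exists_bound_of_continuousOn hkc.continuousOn
    exact ⟨max C 1, by positivity, fun x hx ↦ (hC x hx).trans (le_max_left _ _)⟩
  have hLip : LipschitzOnWith C.toNNReal (fun x ↦ r x - x) (closedBall 0 R) := by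
    refine Convex.lipschitzOnWith_of_nnnorm_hasFDerivWithin_le (𝕜 := ℝ) (f' := k)
      (fun x _ ↦ (hkd x).hasFDerivWithinAt) ?_ (convex_closedBall 0 R)
    intro x hx
    rw [← NNReal.coe_le_coe, Real.coe_toNNReal _ hCpos.le]
    exact hCb x hx
  have hdet0 : ∀ x, (ContinuousLinearMap.id ℝ F + k x).det = 0 := by
    intro x
    have h1 : ContinuousLinearMap.id ℝ F + k x = fderiv ℝ r x := by simp [k]
    rw [h1]
    -- Differentiating `‖r‖ ^ 2 = R ^ 2` shows that the range of the derivative is orthogonal to `r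
    -- x ≠ 0`, so the derivative is not onto.
    by_contra hne
    have hconst : HasFDerivAt (fun y ↦ inner ℝ (r y) (r y)) (0 : F →L[ℝ] ℝ) x := by
      have : (fun y ↦ inner ℝ (r y) (r y)) = fun _ ↦ R ^ 2 := by
        ext y; rw [real_inner_self_eq_norm_sq, hrR]
      rw [this]; exact hasFDerivAt_const _ _
    have h2 := ((hd x).inner ℝ (hd x)).unique hconst
    set e := (fderiv ℝ r x).toContinuousLinearEquivOfDetNeZero hne
    have h3 := congrArg (fun T : F →L[ℝ] ℝ ↦ T (e.symm (r x))) h2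
    have h4 : fderiv ℝ r x (e.symm (r x)) = r x := by
      exact e.apply_symm_apply (r x)
    simp [fderivInnerCLM_apply, h4, hrR] at h3
    nlinarith
  obtain ⟨η, hη, hdetpos⟩ : ∃ η > 0, ∀ B : F →L[ℝ] F, ‖B‖ < η →
      0 < (ContinuousLinearMap.id ℝ F + B).det := by
    have hc : Continuous fun B : F →L[ℝ] F ↦ (ContinuousLinearMap.id ℝ F + B).det :=
      ContinuousLinearMap.continuous_det.comp (continuous_const.add continuous_id)
    have h0 : 0 < (ContinuousLinearMap.id ℝ F + 0).det := by
      rw [add_zero]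
      simp [ContinuousLinearMap.det]
    obtain ⟨η, hη, h⟩ := Metric.eventually_nhds_iff.1 (hc.continuousAt.eventually (lt_mem_nhds h0))
    exact ⟨η, hη, fun B hB ↦ h (by simpa [dist_eq_norm] using hB)⟩
  -- The three bounds give `t < 1`, injectivity of the homotopy, and positivity of its Jacobian
  -- determinant.
  set t0 : ℝ := min (1 / 2) (min (1 / (4 * C)) (η / (2 * C)))
  have ht0 : 0 < t0 := by positivity
  have hint : ∀ t : ℝ, IntegrableOn (fun x ↦ (ContinuousLinearMap.id ℝ F + t • k x).det)
      (ball 0 R) μ := by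
    intro t
    have hc : Continuous fun x ↦ (ContinuousLinearMap.id ℝ F + t • k x).det :=
      ContinuousLinearMap.continuous_det.comp (continuous_const.add (hkc.const_smul t))
    exact (hc.continuousOn.integrableOn_compact (isCompact_closedBall (0 : F) R)).mono_set
      ball_subset_closedBall
  have hvol : ∀ t : ℝ, 0 < t → t ≤ t0 →
      ∫ x in ball 0 R, (ContinuousLinearMap.id ℝ F + t • k x).det ∂μ = μ.real (ball 0 R) := by
    intro t ht htt
    have e1 : t ≤ 1 / 2 := htt.trans (min_le_left _ _)
    have e2 : t ≤ 1 / (4 * C) := htt.trans ((min_le_right _ _).trans (min_le_left _ _))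
    have e3 : t ≤ η / (2 * C) := htt.trans ((min_le_right _ _).trans (min_le_right _ _))
    have e2' : t * C ≤ 1 / 4 := by
      rw [le_div_iff₀ (by positivity)] at e2; linarith
    have e3' : t * C ≤ η / 2 := by
      rw [le_div_iff₀ (by positivity)] at e3; linarith
    obtain ⟨himg, hinj⟩ := image_ball_homotopy r hr.continuous.continuousOn
      (fun x _ ↦ (hrR x).le) hfix hR hLip ht (by linarith)
      (by rw [Real.coe_toNNReal _ hCpos.le]; linarith)
    have hder : ∀ x ∈ ball (0 : F) R, HasFDerivWithinAt (fun x ↦ x + t • (r x - x))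
        (ContinuousLinearMap.id ℝ F + t • k x) (ball 0 R) x := fun x _ ↦
      ((hasFDerivAt_id x).add ((hkd x).const_smul t)).hasFDerivWithinAt
    have h := integral_image_eq_integral_abs_det_fderiv_smul μ measurableSet_ball hder hinj
      (fun _ ↦ (1 : ℝ))
    rw [himg] at h
    simp only [smul_eq_mul, mul_one, integral_const, MeasurableSet.univ, measureReal_restrict_apply,
      univ_inter] at h
    rw [h]
    refine setIntegral_congr_fun measurableSet_ball fun x hx ↦ (abs_of_pos ?_).symm
    apply hdetpos
    rw [norm_smul, Real.norm_of_nonneg ht.le]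
    have := hCb x (ball_subset_closedBall hx)
    nlinarith
  -- The volume of the image is constant for `t ≤ t0` and polynomial in `t`. Interpolating at nodes
  -- in `(0, t0]` carries the constancy to `t = 1`, where the determinant vanishes.
  set v : ℕ → ℝ := fun i ↦ t0 / (i + 1)
  have hv : Function.Injective v := by
    intro i j hij
    simp only [v] at hij
    rw [div_eq_div_iff (by positivity) (by positivity)] at hij
    have := mul_left_cancel₀ ht0.ne' hij
    exact_mod_cast (by linarith : (i : ℝ) = j)
  have hvpos : ∀ i, 0 < v i ∧ v i ≤ t0 := fun i ↦
    ⟨by positivity, div_le_self ht0.le (by linarith [(Nat.cast_nonneg i : (0 : ℝ) ≤ i)])⟩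
  have hsum : ∫ x in ball 0 R, (ContinuousLinearMap.id ℝ F + k x).det ∂μ = μ.real (ball 0 R) := by
    rw [setIntegral_congr_fun measurableSet_ball fun x _ ↦ det_one_add_eq_sum_lagrange v hv (k x)]
    rw [integral_finsetSum _ fun i _ ↦ (hint (v i)).const_mul _]
    simp_rw [integral_const_mul]
    rw [Finset.sum_congr rfl fun i _ ↦ by rw [hvol (v i) (hvpos i).1 (hvpos i).2],
      ← Finset.sum_mul, sum_eval_lagrange_basis_range _ v hv, one_mul]
  simp_rw [hdet0, integral_zero] at hsum
  have hpos : 0 < μ.real (ball (0 : F) R) :=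
    ENNReal.toReal_pos (measure_ball_pos μ 0 hR).ne' measure_ball_lt_top.ne
  exact hpos.ne hsum

/-- A continuous map from a closed ball to its ambient space that fixes the boundary sphere
vanishes somewhere. -/
theorem exists_zero_of_eqOn_sphere {R : ℝ} (hR : 0 < R) (g : F → F)
    (hg : ContinuousOn g (closedBall 0 R)) (hfix : ∀ x ∈ sphere (0 : F) R, g x = x) :
    ∃ x ∈ closedBall (0 : F) R, g x = 0 := by
  classical
  by_contra! hne
  -- Extending by the identity leaves room to smooth the map and keep it the identity far out.
  set G : F → F := (closedBall (0 : F) R).piecewise g id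
  have hGin : ∀ x ∈ closedBall (0 : F) R, G x = g x := fun x hx ↦ piecewise_eq_of_mem _ _ _ hx
  have hGout : ∀ x, R ≤ ‖x‖ → G x = x := by
    intro x hx
    rcases hx.eq_or_lt with h | h
    · rw [hGin x (mem_closedBall_zero_iff.2 h.symm.le), hfix x (mem_sphere_zero_iff_norm.2 h.symm)]
    · exact piecewise_eq_of_notMem _ _ _ (by simpa using h)
  have hGc : Continuous G := by
    refine continuous_piecewise ?_ ?_ continuousOn_id
    · intro x hx
      rw [frontier_closedBall _ hR.ne'] at hx
      exact hfix x hx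
    · rwa [isClosed_closedBall.closure_eq]
  obtain ⟨η, hη, hGη⟩ : ∃ η > 0, ∀ x, η ≤ ‖G x‖ := by
    obtain ⟨x0, hx0, hmin⟩ := (isCompact_closedBall (0 : F) R).exists_isMinOn
      ⟨0, mem_closedBall_self hR.le⟩ hGc.norm.continuousOn
    refine ⟨min ‖G x0‖ R, lt_min (norm_pos_iff.2 ?_) hR, fun x ↦ ?_⟩
    · rw [hGin x0 hx0]; exact hne x0 hx0
    · rcases le_total ‖x‖ R with h | h
      · exact (min_le_left _ _).trans (hmin (mem_closedBall_zero_iff.2 h))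
      · rw [hGout x h]; exact (min_le_right _ _).trans h
  -- Admissible values at `x` of a smooth displacement: within `η` of `G x - x`, so that no zero is
  -- created, and zero beyond radius `2 * R`. Convexity allows gluing by a partition of unity.
  set t : F → Set F := fun x ↦ {w | ‖w - (G x - x)‖ < η ∧ (2 * R ≤ ‖x‖ → w = 0)}
  have htconv : ∀ x, Convex ℝ (t x) := by
    intro x
    have h1 : Convex ℝ {w : F | ‖w - (G x - x)‖ < η} := by
      simpa [ball, dist_eq_norm] using convex_ball (G x - x) η
    have h2 : Convex ℝ {w : F | 2 * R ≤ ‖x‖ → w = 0} := by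
      by_cases h : 2 * R ≤ ‖x‖
      · simp [h]
      · simp [h, convex_univ]
    exact h1.inter h2
  have hloc : ∀ x, ∃ c : F, ∀ᶠ y in 𝓝 x, c ∈ t y := by
    intro x
    rcases lt_or_ge ‖x‖ (2 * R) with h | h
    · refine ⟨G x - x, ?_⟩
      have h1 : ∀ᶠ y in 𝓝 x, ‖y‖ < 2 * R := continuous_norm.continuousAt.eventually (gt_mem_nhds h)
      have h2 : ∀ᶠ y in 𝓝 x, ‖(G x - x) - (G y - y)‖ < η := by
        have : ContinuousAt (fun y ↦ ‖(G x - x) - (G y - y)‖) x :=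
          (continuous_const.sub (hGc.sub continuous_id)).norm.continuousAt
        exact this.eventually (gt_mem_nhds (by simpa using hη))
      filter_upwards [h1, h2] with y hy1 hy2
      exact ⟨hy2, fun h ↦ absurd hy1 h.not_gt⟩
    · refine ⟨0, ?_⟩
      have h1 : ∀ᶠ y in 𝓝 x, R < ‖y‖ :=
        continuous_norm.continuousAt.eventually (lt_mem_nhds (by linarith))
      filter_upwards [h1] with y hy
      exact ⟨by simpa [hGout y hy.le] using hη, fun _ ↦ rfl⟩
  obtain ⟨k, hk⟩ := exists_contMDiffMap_forall_mem_convex_of_local_const (n := ⊤) 𝓘(ℝ, F)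
    htconv hloc
  have hks : ContDiff ℝ ∞ k := k.contMDiff.contDiff
  set f : F → F := fun x ↦ x + k x
  have hfs : ContDiff ℝ ∞ f := contDiff_id.add hks
  have hf0 : ∀ x, f x ≠ 0 := by
    intro x hx
    have h1 := (hk x).1
    have h2 : k x - (G x - x) = f x - G x := by simp only [f]; abel
    rw [h2, hx, zero_sub, norm_neg] at h1
    exact (hGη x).not_gt h1
  have hfout : ∀ x, 2 * R ≤ ‖x‖ → f x = x := fun x hx ↦ by
    simp only [f]; rw [(hk x).2 hx, add_zero]
  -- Radial projection of the zero-free smooth map to the sphere of radius `2 * R` is the forbidden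
  -- retraction.
  refine not_exists_smooth_retraction (by linarith : 0 < 2 * R)
    (fun x ↦ ((2 * R) * ‖f x‖⁻¹) • f x) ?_ ?_ ?_
  · refine ContDiff.smul (contDiff_const.mul ?_) (hfs.of_le (by simp))
    exact ((hfs.of_le (by simp)).norm ℝ hf0).inv fun x ↦ norm_ne_zero_iff.2 (hf0 x)
  · intro x
    have := norm_pos_iff.2 (hf0 x)
    rw [norm_smul, Real.norm_of_nonneg (by positivity)]
    field_simp
  · intro x hx
    have hx' : ‖x‖ = 2 * R := mem_sphere_zero_iff_norm.1 hx
    simp only [hfout x hx'.ge, hx']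
    rw [mul_inv_cancel₀ (by positivity), one_smul]

end Brouwer

/-! ### Tangent and normal spaces in charts -/

section Charts

variable {E : Type*} [NormedAddCommGroup E] [InnerProductSpace ℝ E]

theorem fderiv_symm_comp_fderiv {Φ : OpenPartialHomeomorph E E}
    (hΦ : ContDiffOn ℝ ∞ Φ Φ.source) (hΨ : ContDiffOn ℝ ∞ Φ.symm Φ.target) {z : E}
    (hz : z ∈ Φ.source) :
    (fderiv ℝ Φ.symm (Φ z)).comp (fderiv ℝ Φ z) = ContinuousLinearMap.id ℝ E ∧
      (fderiv ℝ Φ z).comp (fderiv ℝ Φ.symm (Φ z)) = ContinuousLinearMap.id ℝ E := by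
  have h1 : HasFDerivAt Φ (fderiv ℝ Φ z) z :=
    ((hΦ.contDiffAt (Φ.open_source.mem_nhds hz)).differentiableAt (by simp)).hasFDerivAt
  have h2 : HasFDerivAt Φ.symm (fderiv ℝ Φ.symm (Φ z)) (Φ z) :=
    ((hΨ.contDiffAt (Φ.open_target.mem_nhds (Φ.map_source hz))).differentiableAt
      (by simp)).hasFDerivAt
  constructor
  · refine (h2.comp z h1).unique ((hasFDerivAt_id z).congr_of_eventuallyEq ?_)
    filter_upwards [Φ.open_source.mem_nhds hz] with w hw
    exact Φ.left_inv hw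
  · have h1' : HasFDerivAt Φ (fderiv ℝ Φ z) (Φ.symm (Φ z)) := by rwa [Φ.left_inv hz]
    refine (h1'.comp (Φ z) h2).unique ((hasFDerivAt_id (Φ z)).congr_of_eventuallyEq ?_)
    filter_upwards [Φ.open_target.mem_nhds (Φ.map_source hz)] with w hw
    exact Φ.right_inv hw

theorem tangentConeAt_submodule_subset [FiniteDimensional ℝ E] (L : Submodule ℝ E) {y : E}
    (hy : y ∈ L) : tangentConeAt ℝ (L : Set E) y ⊆ L := by
  intro t ht
  obtain ⟨α, l, hl, c, d, -, hd, hcd⟩ := exists_fun_of_mem_tangentConeAt ht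
  refine (Submodule.closed_of_finiteDimensional L).mem_of_tendsto hcd ?_
  filter_upwards [hd] with n hn
  exact L.smul_mem _ ((L.add_mem_iff_right hy).1 hn)

/-- Derivatives map tangent cones into tangent cones. Applied to the chart and to its inverse, this
gives the two inclusions. -/
theorem tangentDirection_eq_map [FiniteDimensional ℝ E] {S : Set E}
    {Φ : OpenPartialHomeomorph E E} {L : Submodule ℝ E}
    (hΦ : ContDiffOn ℝ ∞ Φ Φ.source) (hΨ : ContDiffOn ℝ ∞ Φ.symm Φ.target)
    (hS : ∀ x ∈ Φ.source, x ∈ S ↔ Φ x ∈ L) {z : E} (hz : z ∈ Φ.source) (hzS : z ∈ S) :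
    tangentDirection S z = L.map (fderiv ℝ Φ.symm (Φ z) : E →ₗ[ℝ] E) := by
  have hzL : Φ z ∈ L := (hS z hz).1 hzS
  have h1 : HasFDerivAt Φ (fderiv ℝ Φ z) z :=
    ((hΦ.contDiffAt (Φ.open_source.mem_nhds hz)).differentiableAt (by simp)).hasFDerivAt
  have h2 : HasFDerivAt Φ.symm (fderiv ℝ Φ.symm (Φ z)) (Φ z) :=
    ((hΨ.contDiffAt (Φ.open_target.mem_nhds (Φ.map_source hz))).differentiableAt
      (by simp)).hasFDerivAt
  obtain ⟨hBA, -⟩ := fderiv_symm_comp_fderiv hΦ hΨ hz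
  apply le_antisymm
  · rw [tangentDirection, Submodule.span_le]
    intro t ht
    rw [← tangentConeAt_inter_nhds (Φ.open_source.mem_nhds hz)] at ht
    have h3 := (h1.hasFDerivWithinAt (s := S ∩ Φ.source)).mapsTo_tangent_cone ht
    have h4 : Φ '' (S ∩ Φ.source) ⊆ L := by
      rintro _ ⟨w, ⟨hwS, hw⟩, rfl⟩
      exact (hS w hw).1 hwS
    refine ⟨fderiv ℝ Φ z t, tangentConeAt_submodule_subset L hzL (tangentConeAt_mono h4 h3), ?_⟩
    exact congrArg (fun T : E →L[ℝ] E ↦ T t) hBA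
  · rintro _ ⟨l, hl, rfl⟩
    apply Submodule.subset_span
    have hl' : l ∈ tangentConeAt ℝ ((L : Set E) ∩ Φ.target) (Φ z) := by
      rw [tangentConeAt_inter_nhds (Φ.open_target.mem_nhds (Φ.map_source hz))]
      have h := mem_tangentConeAt_of_segment_subset (s := (L : Set E))
        (L.convex.segment_subset hzL (L.add_mem hzL hl))
      rwa [add_sub_cancel_left] at h
    have h3 := (h2.hasFDerivWithinAt (s := (L : Set E) ∩ Φ.target)).mapsTo_tangent_cone hl'
    rw [Φ.left_inv hz] at h3
    refine tangentConeAt_mono ?_ h3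
    rintro _ ⟨w, ⟨hwL, hw⟩, rfl⟩
    refine (hS _ (Φ.map_target hw)).2 ?_
    rwa [Φ.right_inv hw]

variable [FiniteDimensional ℝ E]

theorem IsSmoothSubmanifold.finrank_tangentDirection {k : ℕ} {S : Set E}
    (hS : IsSmoothSubmanifold k S) {p : E} (hp : p ∈ S) :
    Module.finrank ℝ (tangentDirection S p) = k := by
  obtain ⟨Φ, L, hpΦ, hΦ, hΨ, hL, hSL⟩ := hS p hp
  rw [tangentDirection_eq_map hΦ hΨ hSL hpΦ hp, ← hL]
  obtain ⟨-, hAB⟩ := fderiv_symm_comp_fderiv hΦ hΨ hpΦ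
  have hinj : Function.Injective (fderiv ℝ Φ.symm (Φ p) : E →ₗ[ℝ] E) :=
    Function.LeftInverse.injective (g := fderiv ℝ Φ p)
      fun w ↦ congrArg (fun T : E →L[ℝ] E ↦ T w) hAB
  exact (Submodule.equivMapOfInjective _ hinj L).finrank_eq.symm

theorem IsSmoothSubmanifold.finrank_orthogonal {k : ℕ} {S : Set E}
    (hS : IsSmoothSubmanifold k S) {p : E} (hp : p ∈ S) :
    k + Module.finrank ℝ (tangentDirection S p)ᗮ = Module.finrank ℝ E := by
  rw [← hS.finrank_tangentDirection hp]
  exact Submodule.finrank_add_finrank_orthogonal _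

/-- Points of a submanifold deviate from the tangent space at `p` quadratically in their distance
from `p`. -/
theorem IsSmoothSubmanifold.exists_abs_inner_le {k : ℕ} {S : Set E}
    (hS : IsSmoothSubmanifold k S) {p : E} (hp : p ∈ S) :
    ∃ C > 0, ∃ ρ > 0, ∀ z ∈ S, ‖z - p‖ < ρ → ∀ n ∈ (tangentDirection S p)ᗮ,
      |inner ℝ (z - p) n| ≤ C * ‖z - p‖ ^ 2 * ‖n‖ := by
  obtain ⟨Φ, L, hpΦ, hΦ, hΨ, hL, hSL⟩ := hS p hp
  have hpL : Φ p ∈ L := (hSL p hpΦ).1 hp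
  have hpt := Φ.map_source hpΦ
  set B := fderiv ℝ Φ.symm (Φ p)
  have hΨat : ContDiffAt ℝ ∞ Φ.symm (Φ p) := hΨ.contDiffAt (Φ.open_target.mem_nhds hpt)
  have hB1 : ContDiffAt ℝ 1 (fderiv ℝ Φ.symm) (Φ p) :=
    hΨat.fderiv_right (m := 1) (by norm_cast)
  obtain ⟨K, s, hs, hK⟩ := hB1.exists_lipschitzOnWith
  obtain ⟨K', s', hs', hK'⟩ := (((hΦ.contDiffAt (Φ.open_source.mem_nhds hpΦ)).of_le
    (by simp) : ContDiffAt ℝ 1 Φ p)).exists_lipschitzOnWith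
  obtain ⟨r, hr, hrs⟩ := Metric.mem_nhds_iff.1 (inter_mem hs (Φ.open_target.mem_nhds hpt))
  have hnear : ∀ᶠ z in 𝓝 p, z ∈ s' ∧ z ∈ Φ.source ∧ Φ z ∈ ball (Φ p) r :=
    (eventually_mem_set.2 hs').and ((eventually_mem_set.2 (Φ.open_source.mem_nhds hpΦ)).and
      ((Φ.continuousAt hpΦ).eventually (ball_mem_nhds _ hr)))
  obtain ⟨ρ, hρ, hball⟩ := Metric.eventually_nhds_iff.1 hnear
  refine ⟨K * K' ^ 2 + 1, by positivity, ρ, hρ, fun z hz hzp n hn ↦ ?_⟩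
  obtain ⟨hzs', hzΦ, hzr⟩ := hball (by rwa [dist_eq_norm])
  have hL1 : ‖Φ z - Φ p‖ ≤ K' * ‖z - p‖ := by
    simpa [dist_eq_norm] using hK'.dist_le_mul z hzs' p (mem_of_mem_nhds hs')
  set R := ‖Φ z - Φ p‖
  -- First-order Taylor estimate for the inverse chart, whose derivative is Lipschitz near `Φ p`.
  -- The linear term is tangent, so only this remainder has a normal component.
  have hmv : ‖Φ.symm (Φ z) - Φ.symm (Φ p) - B (Φ z - Φ p)‖ ≤ (K * R) * ‖Φ z - Φ p‖ := by
    have hsub : closedBall (Φ p) R ⊆ ball (Φ p) r :=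
      closedBall_subset_ball (by simpa [R, dist_eq_norm] using hzr)
    refine (convex_closedBall (Φ p) R).norm_image_sub_le_of_norm_hasFDerivWithin_le'
      (f' := fderiv ℝ Φ.symm) (s := closedBall (Φ p) R) ?_ ?_
      (mem_closedBall_self (norm_nonneg _)) (by simp [R, dist_eq_norm])
    · intro y hy
      have hyt := (hrs (hsub hy)).2
      exact ((hΨ.contDiffAt (Φ.open_target.mem_nhds hyt)).differentiableAt
        (by simp)).hasFDerivAt.hasFDerivWithinAt
    · intro y hy
      have := hK.dist_le_mul y (hrs (hsub hy)).1 (Φ p) (mem_of_mem_nhds hs)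
      rw [dist_eq_norm, dist_eq_norm] at this
      refine this.trans ?_
      gcongr
      simpa [dist_eq_norm] using hy
  rw [Φ.left_inv hzΦ, Φ.left_inv hpΦ] at hmv
  have hT : B (Φ z - Φ p) ∈ tangentDirection S p := by
    rw [tangentDirection_eq_map hΦ hΨ hSL hpΦ hp]
    exact ⟨_, L.sub_mem ((hSL z hzΦ).1 hz) hpL, rfl⟩
  have h0 : inner ℝ (B (Φ z - Φ p)) n = 0 := hn _ hT
  have h1 : inner ℝ (z - p) n = inner ℝ (z - p - B (Φ z - Φ p)) n := by
    rw [inner_sub_left (z - p), h0, sub_zero]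
  rw [h1]
  refine (abs_real_inner_le_norm _ _).trans ?_
  refine mul_le_mul_of_nonneg_right (hmv.trans ?_) (norm_nonneg _)
  calc K * R * R = K * R ^ 2 := by ring
    _ ≤ K * (K' * ‖z - p‖) ^ 2 := by gcongr
    _ = K * K' ^ 2 * ‖z - p‖ ^ 2 := by ring
    _ ≤ (K * K' ^ 2 + 1) * ‖z - p‖ ^ 2 := by gcongr; linarith

/-- The vector from a nearest point is normal to the submanifold. -/
theorem IsSmoothSubmanifold.sub_mem_orthogonal {k : ℕ} {S : Set E}
    (hS : IsSmoothSubmanifold k S) {x y : E} (hxy : IsNearestPoint S x y) :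
    x - y ∈ (tangentDirection S y)ᗮ := by
  obtain ⟨Φ, L, hyΦ, hΦ, hΨ, hL, hSL⟩ := hS y hxy.1
  have hyL : Φ y ∈ L := (hSL y hyΦ).1 hxy.1
  have hyt := Φ.map_source hyΦ
  rw [Submodule.mem_orthogonal]
  intro t ht
  rw [tangentDirection_eq_map hΦ hΨ hSL hyΦ hxy.1] at ht
  obtain ⟨l, hl, rfl⟩ := ht
  set B := fderiv ℝ Φ.symm (Φ y)
  have h2 : HasFDerivAt Φ.symm B (Φ y) :=
    ((hΨ.contDiffAt (Φ.open_target.mem_nhds hyt)).differentiableAt (by simp)).hasFDerivAt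
  -- The squared distance to `x` along the curve in `S` with velocity `B l` is minimal at time `0`;
  -- its derivative there gives orthogonality.
  have hline : HasDerivAt (fun s : ℝ ↦ Φ y + s • l) l 0 := by
    simpa using ((hasDerivAt_id (0 : ℝ)).smul_const l).const_add (Φ y)
  have hcurve : HasDerivAt (fun s : ℝ ↦ Φ.symm (Φ y + s • l)) (B l) 0 := by
    refine HasFDerivAt.comp_hasDerivAt (l := Φ.symm) (0 : ℝ) ?_ hline
    simpa using h2
  have hd := (hcurve.const_sub x).norm_sq
  have hmin : IsLocalMin (fun s : ℝ ↦ ‖x - Φ.symm (Φ y + s • l)‖ ^ 2) 0 := by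
    have hev : ∀ᶠ s : ℝ in 𝓝 0, Φ y + s • l ∈ Φ.target :=
      hline.continuousAt.eventually (by simpa using Φ.open_target.mem_nhds hyt)
    filter_upwards [hev] with s hs
    have hmem : Φ.symm (Φ y + s • l) ∈ S := by
      refine (hSL _ (Φ.map_target hs)).2 ?_
      rw [Φ.right_inv hs]
      exact L.add_mem hyL (L.smul_mem _ hl)
    have := hxy.2 _ hmem
    rw [dist_eq_norm, dist_eq_norm] at this
    simp only [zero_smul, add_zero, Φ.left_inv hyΦ]
    gcongr
  have h0 := hmin.hasDerivAt_eq_zero hd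
  simp only [zero_smul, add_zero, Φ.left_inv hyΦ, inner_neg_right] at h0
  rw [real_inner_comm]
  change inner ℝ (x - y) (B l) = 0
  linarith

/-- The orthogonal projection to the normal space varies continuously along a submanifold. -/
theorem IsSmoothSubmanifold.continuousOn_starProjection {k : ℕ} {S : Set E}
    (hS : IsSmoothSubmanifold k S) :
    ContinuousOn (fun z ↦ (tangentDirection S z)ᗮ.starProjection) S := by
  rw [continuousOn_clm_apply]
  intro v p hp
  obtain ⟨Φ, L, hpΦ, hΦ, hΨ, hL, hSL⟩ := hS p hp
  have hpt := Φ.map_source hpΦ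
  set A : E → E →L[ℝ] E := fun z ↦ fderiv ℝ Φ z
  set B : E → E →L[ℝ] E := fun z ↦ fderiv ℝ Φ.symm (Φ z)
  have hAc : ContinuousAt A p :=
    ((hΦ.contDiffAt (Φ.open_source.mem_nhds hpΦ)).fderiv_right (m := 0) (by simp)).continuousAt
  have hBc : ContinuousAt B p :=
    ContinuousAt.comp (f := Φ) (g := fderiv ℝ Φ.symm)
      ((hΨ.contDiffAt (Φ.open_target.mem_nhds hpt)).fderiv_right (m := 0) (by simp)).continuousAt
      (Φ.continuousAt hpΦ)
  have hT : ∀ z ∈ S, z ∈ Φ.source → tangentDirection S z = L.map (B z : E →ₗ[ℝ] E) :=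
    fun z hzS hz ↦ tangentDirection_eq_map hΦ hΨ hSL hz hzS
  have hAB : ∀ z ∈ Φ.source, ∀ w, A z (B z w) = w := fun z hz w ↦
    congrArg (fun T : E →L[ℝ] E ↦ T w) (fderiv_symm_comp_fderiv hΦ hΨ hz).2
  have hBA : ∀ z ∈ Φ.source, ∀ w, B z (A z w) = w := fun z hz w ↦
    congrArg (fun T : E →L[ℝ] E ↦ T w) (fderiv_symm_comp_fderiv hΦ hΨ hz).1
  set N : E → Submodule ℝ E := fun z ↦ (tangentDirection S z)ᗮ
  set t := (tangentDirection S p).starProjection v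
  set n := (N p).starProjection v
  have hv : v = t + n := ((tangentDirection S p).starProjection_add_starProjection_orthogonal v).symm
  have ht : t ∈ tangentDirection S p := Submodule.starProjection_apply_mem _ _
  have hn : n ∈ N p := Submodule.starProjection_apply_mem _ _
  -- A vector tangent at `p` is approximated by the vector `B z (A p t)`, tangent at `z`, which the
  -- normal projection at `z` kills.
  have hlim1 : Tendsto (fun z ↦ (N z).starProjection t) (𝓝[S] p) (𝓝 0) := by
    have hc : Tendsto (fun z ↦ ‖t - B z (A p t)‖) (𝓝[S] p) (𝓝 0) := by
      have : ContinuousAt (fun z ↦ ‖t - B z (A p t)‖) p :=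
        (continuousAt_const.sub (hBc.clm_apply continuousAt_const)).norm
      have h := this.tendsto
      rw [hBA p hpΦ, sub_self, norm_zero] at h
      exact h.mono_left nhdsWithin_le_nhds
    refine squeeze_zero_norm' ?_ hc
    filter_upwards [self_mem_nhdsWithin, nhdsWithin_le_nhds (Φ.open_source.mem_nhds hpΦ)]
      with z hzS hz
    have hmem : B z (A p t) ∈ tangentDirection S z := by
      rw [hT p hp hpΦ] at ht
      obtain ⟨l, hl, hlt⟩ := ht
      rw [hT z hzS hz]
      refine ⟨l, hl, ?_⟩
      rw [← hlt]
      change B z l = B z (A p (B p l))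
      rw [hAB p hpΦ]
    have h0 : (N z).starProjection (B z (A p t)) = 0 := by
      rw [Submodule.starProjection_apply_eq_zero_iff]
      exact Submodule.le_orthogonal_orthogonal _ hmem
    have : (N z).starProjection t = (N z).starProjection (t - B z (A p t)) := by
      rw [map_sub, h0, sub_zero]
    rw [this]
    exact Submodule.norm_starProjection_apply_le _ _
  -- Dually, the tangential part `w` at `z` of the normal vector `n` is moved by `B p ∘ A z`, which
  -- is close to the identity, to a vector orthogonal to `n`. Hence `‖w‖ ^ 2 = ⟪w, n⟫` is small
  -- compared to `‖w‖`.
  have hlim2 : Tendsto (fun z ↦ (tangentDirection S z).starProjection n) (𝓝[S] p) (𝓝 0) := by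
    have hc : Tendsto (fun z ↦ ‖ContinuousLinearMap.id ℝ E - (B p).comp (A z)‖ * ‖n‖)
        (𝓝[S] p) (𝓝 0) := by
      have : ContinuousAt (fun z ↦ ‖ContinuousLinearMap.id ℝ E - (B p).comp (A z)‖ * ‖n‖) p :=
        ((continuousAt_const.sub (continuousAt_const.clm_comp hAc)).norm).mul continuousAt_const
      have h := this.tendsto
      have h1 : (B p).comp (A p) = ContinuousLinearMap.id ℝ E :=
        (fderiv_symm_comp_fderiv hΦ hΨ hpΦ).1
      rw [h1, sub_self, norm_zero, zero_mul] at h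
      exact h.mono_left nhdsWithin_le_nhds
    refine squeeze_zero_norm' ?_ hc
    filter_upwards [self_mem_nhdsWithin, nhdsWithin_le_nhds (Φ.open_source.mem_nhds hpΦ)]
      with z hzS hz
    set w := (tangentDirection S z).starProjection n
    have hw : w ∈ tangentDirection S z := Submodule.starProjection_apply_mem _ _
    have hmem : B p (A z w) ∈ tangentDirection S p := by
      rw [hT z hzS hz] at hw
      obtain ⟨l, hl, hlw⟩ := hw
      rw [hT p hp hpΦ]
      refine ⟨l, hl, ?_⟩
      rw [← hlw]
      change B p l = B p (A z (B z l))
      rw [hAB z hz]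
    have h0 : inner ℝ (B p (A z w)) n = 0 := hn _ hmem
    have h1 : ‖w‖ ^ 2 = inner ℝ w n := by
      rw [← real_inner_self_eq_norm_sq]
      have h3 : inner ℝ w (n - w) = 0 :=
        (Submodule.sub_starProjection_mem_orthogonal n) w hw
      rw [inner_sub_right] at h3
      linarith
    have h2 : ‖w‖ ^ 2 ≤ ‖w‖ * (‖ContinuousLinearMap.id ℝ E - (B p).comp (A z)‖ * ‖n‖) := by
      have h3 : inner ℝ w n =
          inner ℝ ((ContinuousLinearMap.id ℝ E - (B p).comp (A z)) w) n := by
        simp [inner_sub_left, h0]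
      rw [h1, h3]
      refine (real_inner_le_norm _ _).trans ?_
      have := (ContinuousLinearMap.id ℝ E - (B p).comp (A z)).le_opNorm w
      nlinarith [norm_nonneg n]
    rcases (norm_nonneg w).eq_or_lt with h | h
    · rw [← h]; positivity
    · rw [pow_two] at h2
      exact le_of_mul_le_mul_left h2 h
  change Tendsto (fun z ↦ (N z).starProjection v) (𝓝[S] p) (𝓝 n)
  have heq : ∀ z, (N z).starProjection v =
      (N z).starProjection t + (n - (tangentDirection S z).starProjection n) := by
    intro z
    have := (tangentDirection S z).starProjection_add_starProjection_orthogonal n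
    conv_lhs => rw [hv, map_add]
    congr 1
    exact eq_sub_of_add_eq' this
  simp_rw [heq]
  simpa using hlim1.add (tendsto_const_nhds.sub hlim2)

end Charts

/-! ### Nearest points and the medial axis -/

section Nearest

variable {E : Type*} [NormedAddCommGroup E]

theorem isClosed_medialAxis (S : Set E) : IsClosed (medialAxis S) := isClosed_closure

theorem IsNearestPoint.eq_of_notMem_medialAxis {S : Set E} {x a b : E}
    (ha : IsNearestPoint S x a) (hb : IsNearestPoint S x b) (hx : x ∉ medialAxis S) : a = b := by
  by_contra hab
  exact hx (subset_closure ⟨a, b, hab, ha, hb⟩)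

theorem isNearestPoint_self {S : Set E} {x : E} (hx : x ∈ S) : IsNearestPoint S x x :=
  ⟨hx, fun z _ ↦ by rw [dist_self]; exact dist_nonneg⟩

theorem IsNearestPoint.infDist_eq {S : Set E} {x y : E} (h : IsNearestPoint S x y) :
    infDist x S = dist x y :=
  le_antisymm (infDist_le_dist_of_mem h.1) ((le_infDist ⟨y, h.1⟩).2 fun {z} hz ↦ h.2 z hz)

theorem isNearestPoint_of_le_infDist {S : Set E} {x y : E} (hy : y ∈ S)
    (h : dist x y ≤ infDist x S) : IsNearestPoint S x y :=
  ⟨hy, fun _ hz ↦ h.trans (infDist_le_dist_of_mem hz)⟩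

/-- A chosen nearest point of `S`. -/
noncomputable def nearestPoint (S : Set E) (x : E) : E :=
  Classical.epsilon (IsNearestPoint S x)

theorem isNearestPoint_nearestPoint {S : Set E} (hS : IsCompact S) (hne : S.Nonempty) (x : E) :
    IsNearestPoint S x (nearestPoint S x) := by
  obtain ⟨y, hy, hxy⟩ := hS.exists_infDist_eq_dist hne x
  exact Classical.epsilon_spec (p := IsNearestPoint S x)
    ⟨y, isNearestPoint_of_le_infDist hy hxy.ge⟩

/-- By compactness it is enough that each cluster point of nearest points is itself nearest to `x`;
off the medial axis there is only one such point. -/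
theorem continuousAt_nearestPoint {S : Set E} (hS : IsCompact S) (hne : S.Nonempty) {x : E}
    (hx : x ∉ medialAxis S) : ContinuousAt (nearestPoint S) x := by
  have hπ := isNearestPoint_nearestPoint hS hne
  refine hS.tendsto_nhds_of_unique_mapClusterPt (Eventually.of_forall fun w ↦ (hπ w).1) ?_
  intro y hy hcl
  refine IsNearestPoint.eq_of_notMem_medialAxis ⟨hy, fun z hz ↦ ?_⟩ (hπ x) hx
  by_contra! hlt
  set ε := (dist x y - dist x z) / 4
  have hε : 0 < ε := by simp only [ε]; linarith
  have hfreq := (hcl.frequently (ball_mem_nhds y hε)).and_eventually (ball_mem_nhds x hε)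
  obtain ⟨w, hw1, hw2⟩ := hfreq.exists
  change dist (nearestPoint S w) y < ε at hw1
  change dist w x < ε at hw2
  have h1 := (hπ w).2 z hz
  have h2 := dist_triangle4 x w (nearestPoint S w) y
  have h3 := dist_triangle w x z
  rw [dist_comm x w] at h2
  simp only [ε] at *
  linarith

theorem notMem_medialAxis_of_mem_closedBall {S : Set E} {p y : E} {ρ : ℝ} (hρ : ρ < lfs S p)
    (hy : y ∈ closedBall p ρ) : y ∉ medialAxis S :=
  notMem_of_dist_lt_infDist (x := p) (by rw [dist_comm]; exact (mem_closedBall.1 hy).trans_lt hρ)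

end Nearest

/-! ### Normal rays and empty tangent balls -/

section NormalRays

variable {E : Type*} [NormedAddCommGroup E] [InnerProductSpace ℝ E]

/-- Away from the set and its medial axis, the distance to `S` grows at unit speed in the direction
away from the nearest point. -/
theorem eventually_infDist_add_smul_gt {S : Set E} (hS : IsCompact S) (hne : S.Nonempty) {x : E}
    (hx : x ∉ medialAxis S) (hpos : 0 < infDist x S) {c : ℝ} (hc0 : 0 < c) (hc : c < 1) :
    ∃ m : E, ‖m‖ = 1 ∧ ∀ᶠ h : ℝ in 𝓝[>] 0, infDist x S + c * h < infDist (x + h • m) S := by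
  have hπ := isNearestPoint_nearestPoint hS hne
  set d := infDist x S with hd
  have hdx : ‖x - nearestPoint S x‖ = d := by rw [hd, (hπ x).infDist_eq, dist_eq_norm]
  refine ⟨d⁻¹ • (x - nearestPoint S x), ?_, ?_⟩
  · rw [norm_smul, hdx, norm_inv, Real.norm_of_nonneg hpos.le, inv_mul_cancel₀ hpos.ne']
  set m := d⁻¹ • (x - nearestPoint S x)
  have hm : ‖m‖ = 1 := by
    rw [norm_smul, hdx, norm_inv, Real.norm_of_nonneg hpos.le, inv_mul_cancel₀ hpos.ne']
  -- Continuity of the nearest point makes this inner product exceed `c * d` for small `h`;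
  -- expanding the square then beats `(d + c * h) ^ 2` because `c < 1`.
  have hlim : Tendsto (fun h : ℝ ↦ inner ℝ m (x - nearestPoint S (x + h • m))) (𝓝 0) (𝓝 d) := by
    have h1 : ContinuousAt (fun h : ℝ ↦ nearestPoint S (x + h • m)) 0 := by
      refine ContinuousAt.comp (g := nearestPoint S) ?_ (by fun_prop)
      simpa using continuousAt_nearestPoint hS hne hx
    have h2 : ContinuousAt (fun h : ℝ ↦ inner ℝ m (x - nearestPoint S (x + h • m))) 0 :=
      ContinuousAt.inner (𝕜 := ℝ) continuousAt_const (continuousAt_const.sub h1)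
    have h3 := h2.tendsto
    have h4 : inner ℝ m (x - nearestPoint S (x + (0 : ℝ) • m)) = d := by
      rw [zero_smul, add_zero, real_inner_smul_left, real_inner_self_eq_norm_sq, hdx]
      field_simp
    rwa [h4] at h3
  have hev : ∀ᶠ h : ℝ in 𝓝 0, c * d < inner ℝ m (x - nearestPoint S (x + h • m)) :=
    hlim.eventually (lt_mem_nhds (by nlinarith))
  filter_upwards [nhdsWithin_le_nhds hev, self_mem_nhdsWithin] with h hh hh0
  have hh0 : 0 < h := hh0
  rw [(hπ (x + h • m)).infDist_eq, dist_eq_norm]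
  set y := nearestPoint S (x + h • m)
  have h1 : d ≤ ‖x - y‖ := by
    rw [← dist_eq_norm]; exact infDist_le_dist_of_mem (hπ _).1
  have h2 : ‖x + h • m - y‖ ^ 2 = ‖x - y‖ ^ 2 + 2 * h * inner ℝ m (x - y) + h ^ 2 := by
    have : x + h • m - y = (x - y) + h • m := by abel
    rw [this, norm_add_sq_real, real_inner_smul_right, norm_smul, hm, mul_one, Real.norm_eq_abs,
      sq_abs, real_inner_comm]
    ring
  refine lt_of_pow_lt_pow_left₀ 2 (norm_nonneg _) ?_
  rw [h2]
  have h3 : d ^ 2 ≤ ‖x - y‖ ^ 2 := by gcongr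
  have h4 : h * (c * d) < h * inner ℝ m (x - y) := mul_lt_mul_of_pos_left hh hh0
  have h5 : c ^ 2 * h ^ 2 < h ^ 2 := by
    have : c ^ 2 < 1 := by nlinarith
    have h6 : 0 < h ^ 2 := by positivity
    nlinarith
  nlinarith

/-- If the distance from `S` is realized by `p` at a point of a ray from `p` that is not on the
medial axis, then it is also realized by `p` somewhat further along the ray. -/
theorem IsNearestPoint.exists_extend [FiniteDimensional ℝ E] {S : Set E} (hS : IsCompact S)
    {p n : E} (hn : ‖n‖ = 1) {t : ℝ} (ht : 0 < t) (hp : IsNearestPoint S (p + t • n) p)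
    (hM : p + t • n ∉ medialAxis S) :
    ∃ ρ > (0 : ℝ), IsNearestPoint S (p + (t + ρ) • n) p := by
  have hne : S.Nonempty := ⟨p, hp.1⟩
  set q := p + t • n with hq
  have hdq : infDist q S = t := by
    rw [hp.infDist_eq, dist_eq_norm, hq, add_sub_cancel_left, norm_smul, hn, mul_one,
      Real.norm_of_nonneg ht.le]
  obtain ⟨r, hr, hrM⟩ := Metric.isOpen_iff.1 (isClosed_medialAxis S).isOpen_compl q hM
  set ρ := min (r / 2) (t / 2)
  have hρ : 0 < ρ := by positivity
  have hρr : ρ < r := (min_le_left _ _).trans_lt (by linarith)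
  have hρt : ρ < t := (min_le_right _ _).trans_lt (by linarith)
  have hsph : q + ρ • n ∈ sphere q ρ := by
    simp [norm_smul, hn, abs_of_pos hρ]
  -- Maximize `infDist y S - c * dist y q` over the closed ball. Growth of the distance at a rate
  -- above `c` rules out an interior maximum, so the maximum lies on the sphere. This replaces
  -- following the gradient flow of the distance.
  have hstep : ∀ c : ℝ, 0 < c → c < 1 → ∃ y ∈ sphere q ρ, t + c * ρ ≤ infDist y S := by
    intro c hc0 hc1
    have hcont : Continuous fun y ↦ infDist y S - c * dist y q := by fun_prop
    obtain ⟨y, hy, hmax⟩ := (isCompact_closedBall q ρ).exists_isMaxOn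
      ⟨q, mem_closedBall_self hρ.le⟩ hcont.continuousOn
    have hyq : infDist q S ≤ infDist y S - c * dist y q := by
      have := hmax (mem_closedBall_self hρ.le)
      simpa using this
    rcases (mem_closedBall.1 hy).lt_or_eq with hlt | heq
    · exfalso
      have hyM : y ∉ medialAxis S := hrM (mem_ball.2 (hlt.trans hρr))
      have hypos : 0 < infDist y S := by
        have : 0 ≤ c * dist y q := by positivity
        linarith
      obtain ⟨m, hm, hev⟩ := eventually_infDist_add_smul_gt hS hne hyM hypos hc0 hc1
      have hev2 : ∀ᶠ h : ℝ in 𝓝[>] 0, y + h • m ∈ ball q ρ := by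
        have : ContinuousAt (fun h : ℝ ↦ y + h • m) 0 := by fun_prop
        exact nhdsWithin_le_nhds
          (this.eventually (isOpen_ball.mem_nhds (by simpa using hlt)))
      obtain ⟨h, ⟨h1, h2⟩, h3⟩ := ((hev.and hev2).and self_mem_nhdsWithin).exists
      have h3 : 0 < h := h3
      have h4 : infDist (y + h • m) S - c * dist (y + h • m) q ≤ infDist y S - c * dist y q :=
        hmax (ball_subset_closedBall h2)
      have h5 : dist (y + h • m) q ≤ h + dist y q := by
        refine (dist_triangle _ y _).trans_eq ?_
        rw [dist_eq_norm (y + h • m), add_sub_cancel_left, norm_smul, hm, mul_one,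
          Real.norm_of_nonneg h3.le]
      nlinarith
    · exact ⟨y, heq, by rw [heq, hdq] at hyq; linarith⟩
  obtain ⟨y, hy, hmax⟩ := (isCompact_sphere q ρ).exists_isMaxOn ⟨_, hsph⟩
    (continuous_infDist_pt S).continuousOn
  have hyd : t + ρ ≤ infDist y S := by
    by_contra! hlt
    -- If the maximum over the sphere fell short of `t + ρ`, some slope `c < 1` would already exceed
    -- it: the midpoint of `(infDist y S - t) / ρ` and `1`.
    have hc : ∃ c : ℝ, 0 < c ∧ c < 1 ∧ infDist y S < t + c * ρ := by
      have hy0 : t ≤ infDist y S := by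
        obtain ⟨z, hz, hzd⟩ := hstep (1 / 2) (by norm_num) (by norm_num)
        have := hmax hz
        simp only [mem_ofPred] at this
        linarith
      refine ⟨((infDist y S - t) / ρ + 1) / 2, ?_, ?_, ?_⟩
      · have : 0 ≤ (infDist y S - t) / ρ := div_nonneg (by linarith) hρ.le
        linarith
      · have : (infDist y S - t) / ρ < 1 := by rw [div_lt_one hρ]; linarith
        linarith
      · field_simp
        linarith
    obtain ⟨c, hc0, hc1, hc2⟩ := hc
    obtain ⟨z, hz, hzd⟩ := hstep c hc0 hc1
    have := hmax hz
    simp only [mem_ofPred] at this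
    linarith
  have hyp : t + ρ ≤ ‖y - p‖ := by
    rw [← dist_eq_norm]; exact hyd.trans (infDist_le_dist_of_mem hp.1)
  have hyq : ‖y - q‖ = ρ := by rw [← dist_eq_norm]; exact hy
  -- Equality is forced in the triangle inequality for `p`, `q`, `y`, so `y` lies on the ray.
  have hin : ρ ≤ inner ℝ (y - q) n := by
    have h1 : y - p = (y - q) + t • n := by rw [hq]; abel
    have h2 : (t + ρ) ^ 2 ≤ ‖y - p‖ ^ 2 := by gcongr
    rw [h1, norm_add_sq_real, hyq, real_inner_smul_right, norm_smul, hn, mul_one,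
      Real.norm_of_nonneg ht.le] at h2
    nlinarith
  have hyeq : y = p + (t + ρ) • n := by
    have h1 : ‖y - q - ρ • n‖ ^ 2 ≤ 0 := by
      rw [norm_sub_sq_real, hyq, real_inner_smul_right, norm_smul, hn, mul_one,
        Real.norm_of_nonneg hρ.le]
      nlinarith
    have h2 : y - q - ρ • n = 0 := by
      rw [← norm_eq_zero]
      exact pow_eq_zero_iff two_ne_zero |>.1 (le_antisymm h1 (by positivity))
    rw [add_smul, ← add_assoc, ← hq]
    rw [sub_sub, sub_eq_zero] at h2
    exact h2
  refine ⟨ρ, hρ, hyeq ▸ isNearestPoint_of_le_infDist hp.1 ?_⟩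
  refine le_trans (le_of_eq ?_) hyd
  rw [dist_eq_norm, hyeq, add_sub_cancel_left, norm_smul, hn, mul_one,
    Real.norm_of_nonneg (by positivity)]

theorem IsNearestPoint.of_le {S : Set E} {p n : E} (hn : ‖n‖ = 1) {s t : ℝ} (hs : 0 ≤ s)
    (hst : s ≤ t) (hp : IsNearestPoint S (p + t • n) p) : IsNearestPoint S (p + s • n) p := by
  refine ⟨hp.1, fun z hz ↦ ?_⟩
  have h1 := hp.2 z hz
  have h2 := dist_triangle (p + t • n) (p + s • n) z
  have h3 : dist (p + t • n) (p + s • n) = t - s := by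
    rw [dist_eq_norm, add_sub_add_left_eq_sub, ← sub_smul, norm_smul, hn, mul_one,
      Real.norm_of_nonneg (by linarith)]
  have h4 : ∀ r : ℝ, 0 ≤ r → dist (p + r • n) p = r := fun r hr ↦ by
    rw [dist_eq_norm, add_sub_cancel_left, norm_smul, hn, mul_one, Real.norm_of_nonneg hr]
  rw [h4 t (hs.trans hst)] at h1
  rw [h4 s hs]
  linarith

variable [FiniteDimensional ℝ E]

theorem IsSmoothSubmanifold.exists_isNearestPoint_add_smul {k : ℕ} {S : Set E}
    (hS : IsSmoothSubmanifold k S) {p n : E} (hp : p ∈ S) (hn : n ∈ (tangentDirection S p)ᗮ)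
    (hn1 : ‖n‖ = 1) : ∃ t > (0 : ℝ), IsNearestPoint S (p + t • n) p := by
  obtain ⟨C, hC, ρ, hρ, h⟩ := hS.exists_abs_inner_le hp
  refine ⟨min (1 / (2 * C)) (ρ / 2), by positivity, hp, fun z hz ↦ ?_⟩
  set t := min (1 / (2 * C)) (ρ / 2)
  have ht : 0 < t := by positivity
  have h1 : dist (p + t • n) p = t := by
    rw [dist_eq_norm, add_sub_cancel_left, norm_smul, hn1, mul_one, Real.norm_of_nonneg ht.le]
  rw [h1]
  rcases lt_or_ge ‖z - p‖ ρ with hlt | hge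
  · have h2 := h z hz hlt n hn
    rw [hn1, mul_one] at h2
    have h3 : t * (2 * C) ≤ 1 := by
      have : t ≤ 1 / (2 * C) := min_le_left _ _
      rwa [le_div_iff₀ (by positivity)] at this
    rw [dist_comm, dist_eq_norm]
    refine le_of_sq_le_sq ?_ (norm_nonneg _)
    have h4 : z - (p + t • n) = (z - p) - t • n := by abel
    rw [h4, norm_sub_sq_real, real_inner_smul_right, norm_smul, hn1, mul_one,
      Real.norm_of_nonneg ht.le]
    have h5 := (abs_le.1 h2).2
    have h6 : t * inner ℝ (z - p) n ≤ t * (C * ‖z - p‖ ^ 2) := by gcongr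
    have h7 : (t * (2 * C)) * ‖z - p‖ ^ 2 ≤ 1 * ‖z - p‖ ^ 2 := by gcongr
    nlinarith
  · have h2 : t ≤ ρ / 2 := min_le_right _ _
    have h3 := dist_triangle z (p + t • n) p
    rw [h1, dist_eq_norm z p, dist_comm z] at h3
    linarith

/-- On a normal ray from `p`, the point `p` stays the nearest point of `S` until the ray meets the
medial axis. -/
theorem IsSmoothSubmanifold.isNearestPoint_add_smul {k : ℕ} {S : Set E} (hSc : IsCompact S)
    (hS : IsSmoothSubmanifold k S) {p n : E} (hp : p ∈ S) (hn : n ∈ (tangentDirection S p)ᗮ)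
    (hn1 : ‖n‖ = 1) {T : ℝ} (hT : 0 ≤ T)
    (hM : ∀ s : ℝ, 0 < s → s < T → p + s • n ∉ medialAxis S) :
    IsNearestPoint S (p + T • n) p := by
  set A : Set ℝ := {s | IsNearestPoint S (p + s • n) p}
  have hA : IsClosed A := by
    have : A = ⋂ z ∈ S, {s : ℝ | dist (p + s • n) p ≤ dist (p + s • n) z} := by
      ext s
      simp only [A, IsNearestPoint, hp, true_and, mem_iInter, mem_ofPred]
    rw [this]
    exact isClosed_biInter fun z _ ↦ isClosed_le (by fun_prop) (by fun_prop)
  have hsub : Icc 0 T ⊆ A := by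
    -- Continuous induction: the set of good parameters is closed, and from each good parameter
    -- below `T` it extends a little further.
    refine (hA.inter isClosed_Icc).Icc_subset_of_forall_exists_gt ?_ ?_
    · simpa [A] using isNearestPoint_self hp
    · rintro s ⟨hsA, hs0, hsT⟩ y hy
      have hy : s < y := hy
      obtain ⟨s', hs', hs'A⟩ : ∃ s' > s, s' ∈ A := by
        rcases hs0.eq_or_lt with h | h
        · obtain ⟨t, ht, htA⟩ := hS.exists_isNearestPoint_add_smul hp hn hn1
          exact ⟨t, h ▸ ht, htA⟩
        · obtain ⟨ρ, hρ, h⟩ := IsNearestPoint.exists_extend hSc hn1 h hsA (hM s h hsT)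
          exact ⟨s + ρ, by linarith, h⟩
      refine ⟨min s' y, IsNearestPoint.of_le hn1 ?_ (min_le_left _ _) hs'A, lt_min hs' hy,
        min_le_right _ _⟩
      exact hs0.trans (le_min hs'.le hy.le)
  exact hsub (right_mem_Icc.2 hT)

theorem IsSmoothSubmanifold.isNearestPoint_add {k : ℕ} {S : Set E} (hSc : IsCompact S)
    (hS : IsSmoothSubmanifold k S) {p n : E} (hp : p ∈ S) (hn : n ∈ (tangentDirection S p)ᗮ)
    (hM : ∀ s : ℝ, 0 < s → s < 1 → p + s • n ∉ medialAxis S) :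
    IsNearestPoint S (p + n) p := by
  rcases eq_or_ne n 0 with rfl | h0
  · simpa using isNearestPoint_self hp
  have hpos : 0 < ‖n‖ := norm_pos_iff.2 h0
  have h := hS.isNearestPoint_add_smul hSc hp (n := ‖n‖⁻¹ • n) (Submodule.smul_mem _ _ hn)
    (by rw [norm_smul, norm_inv, norm_norm, inv_mul_cancel₀ hpos.ne']) hpos.le ?_
  · rwa [smul_smul, mul_inv_cancel₀ hpos.ne', one_smul] at h
  · intro s hs hsn
    rw [smul_smul]
    refine hM _ (by positivity) ?_
    rwa [← div_eq_mul_inv, div_lt_one hpos]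

/-- A ball tangent to `S` at `p` whose radius is at most the local feature size contains no point
of `S`. -/
theorem IsSmoothSubmanifold.two_mul_lfs_mul_inner_le {k : ℕ} {S : Set E} (hSc : IsCompact S)
    (hS : IsSmoothSubmanifold k S) {p n z : E} (hp : p ∈ S) (hn : n ∈ (tangentDirection S p)ᗮ)
    (hz : z ∈ S) : 2 * lfs S p * inner ℝ (z - p) n ≤ ‖z - p‖ ^ 2 * ‖n‖ := by
  rcases eq_or_ne n 0 with rfl | h0
  · simp
  have hpos : 0 < ‖n‖ := norm_pos_iff.2 h0
  set l := lfs S p with hl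
  have hl0 : 0 ≤ l := infDist_nonneg
  rcases hl0.eq_or_lt with h | h
  · rw [← h, mul_zero, zero_mul]
    positivity
  have hln : ‖(l * ‖n‖⁻¹) • n‖ = l := by
    rw [norm_smul, Real.norm_of_nonneg (by positivity), mul_assoc, inv_mul_cancel₀ hpos.ne',
      mul_one]
  -- All points of the segment before its end are closer to `p` than the medial axis, so the ball of
  -- radius `l` about the end is empty; expanding the square of the distance to `z` gives the claim.
  have hnear : IsNearestPoint S (p + (l * ‖n‖⁻¹) • n) p := by
    refine hS.isNearestPoint_add hSc hp (Submodule.smul_mem _ _ hn) fun s hs hs1 ↦ ?_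
    refine notMem_of_dist_lt_infDist (x := p) ?_
    rw [dist_comm, dist_eq_norm, add_sub_cancel_left, norm_smul, hln, Real.norm_of_nonneg hs.le]
    change s * l < l
    nlinarith
  have h1 := hnear.2 z hz
  rw [dist_eq_norm, add_sub_cancel_left, hln, dist_comm, dist_eq_norm] at h1
  have h2 : z - (p + (l * ‖n‖⁻¹) • n) = (z - p) - (l * ‖n‖⁻¹) • n := by abel
  have h3 : l ^ 2 ≤ ‖z - (p + (l * ‖n‖⁻¹) • n)‖ ^ 2 := by gcongr
  rw [h2, norm_sub_sq_real, hln, real_inner_smul_right] at h3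
  have h4 : 2 * (l * ‖n‖⁻¹ * inner ℝ (z - p) n) ≤ ‖z - p‖ ^ 2 := by linarith
  calc 2 * l * inner ℝ (z - p) n = 2 * (l * ‖n‖⁻¹ * inner ℝ (z - p) n) * ‖n‖ := by
        field_simp
    _ ≤ _ := by gcongr

end NormalRays

/-! ### Transport along a continuous family of projections -/

section Transport

variable {E : Type*} [NormedAddCommGroup E] [InnerProductSpace ℝ E]

/-- Composition of the operators `Q` along the points dividing the segment from `p` to `y`. -/
noncomputable def transportAux (Q : E → E →L[ℝ] E) (p : E) (J : ℕ) : ℕ → E → E →L[ℝ] E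
  | 0, _ => Q p
  | j + 1, y => (transportAux Q p J j y).comp (Q (p + ((j + 1 : ℕ) / J : ℝ) • (y - p)))

/-- A continuous family of projections over a ball can be transported to the center without
collapsing. -/
theorem exists_transport [FiniteDimensional ℝ E] {p : E} {ρ : ℝ} (hρ : 0 ≤ ρ)
    (Q : E → E →L[ℝ] E) (hQ : ContinuousOn Q (closedBall p ρ))
    (hidem : ∀ y v, Q y (Q y v) = Q y v) :
    ∃ V : E → E →L[ℝ] E, ContinuousOn V (closedBall p ρ) ∧
      (∀ y ∈ closedBall p ρ, ∀ n, Q y n = n → n ≠ 0 → V y n ≠ 0) ∧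
      (∀ y v, Q p (V y v) = V y v) ∧
      ∀ y, (∀ s ∈ Icc (0 : ℝ) 1, Q (p + s • (y - p)) = Q p) → V y = Q p := by
  -- With `J` steps, consecutive projections differ by less than `1` in norm, so the next projection
  -- cannot kill a nonzero vector fixed by the previous one.
  have huc := (isCompact_closedBall p ρ).uniformContinuousOn_of_continuous hQ
  obtain ⟨δ, hδ, hδQ⟩ := Metric.uniformContinuousOn_iff.1 huc 1 one_pos
  obtain ⟨J, hJ⟩ := exists_nat_gt (ρ / δ)
  have hJ0 : (0 : ℝ) < J := lt_of_le_of_lt (by positivity) hJ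
  have hmem : ∀ y ∈ closedBall p ρ, ∀ s ∈ Icc (0 : ℝ) 1, p + s • (y - p) ∈ closedBall p ρ := by
    intro y hy s hs
    rw [mem_closedBall, dist_eq_norm] at hy ⊢
    rw [add_sub_cancel_left, norm_smul, Real.norm_of_nonneg hs.1]
    exact (mul_le_of_le_one_left (norm_nonneg _) hs.2).trans hy
  have hfrac : ∀ j : ℕ, j ≤ J → (j / J : ℝ) ∈ Icc (0 : ℝ) 1 := by
    intro j hj
    refine ⟨by positivity, ?_⟩
    rw [div_le_one hJ0]
    exact_mod_cast hj
  refine ⟨transportAux Q p J J, ?_, ?_, ?_, ?_⟩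
  · have h : ∀ j : ℕ, j ≤ J → ContinuousOn (transportAux Q p J j) (closedBall p ρ) := by
      intro j
      induction j with
      | zero => exact fun _ ↦ continuousOn_const
      | succ j ih =>
        intro hj
        refine (ih (by omega)).clm_comp ?_
        refine hQ.comp (by fun_prop) fun y hy ↦ hmem y hy _ (hfrac _ hj)
    exact h J le_rfl
  · intro y hy
    have hfix : ∀ j v, transportAux Q p J j y (Q (p + (j / J : ℝ) • (y - p)) v) =
        transportAux Q p J j y v := by
      intro j v
      cases j with
      | zero => simp [transportAux, hidem]
      | succ j => simp only [transportAux, ContinuousLinearMap.comp_apply, hidem]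
    have h : ∀ j : ℕ, j ≤ J → ∀ n, Q (p + (j / J : ℝ) • (y - p)) n = n → n ≠ 0 →
        transportAux Q p J j y n ≠ 0 := by
      intro j
      induction j with
      | zero =>
        intro _ n hn hn0
        simp only [Nat.cast_zero, zero_div, zero_smul, add_zero] at hn
        simpa [transportAux, hn] using hn0
      | succ j ih =>
        intro hj n hn hn0
        simp only [transportAux, ContinuousLinearMap.comp_apply, hn]
        rw [← hfix]
        refine ih (by omega) _ (hidem _ _) fun h0 ↦ ?_
        have hd : dist (p + ((j + 1 : ℕ) / J : ℝ) • (y - p)) (p + (j / J : ℝ) • (y - p)) < δ := by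
          rw [dist_eq_norm, add_sub_add_left_eq_sub, ← sub_smul, norm_smul]
          have h1 : ((j + 1 : ℕ) / J : ℝ) - j / J = 1 / J := by push_cast; ring
          rw [h1, Real.norm_of_nonneg (by positivity)]
          rw [mem_closedBall, dist_eq_norm] at hy
          rw [div_lt_iff₀ hδ] at hJ
          rw [one_div, inv_mul_lt_iff₀ hJ0]
          linarith
        have h2 := hδQ _ (hmem y hy _ (hfrac _ hj)) _ (hmem y hy _ (hfrac j (by omega))) hd
        rw [dist_eq_norm] at h2
        have h3 := (Q (p + ((j + 1 : ℕ) / J : ℝ) • (y - p)) -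
          Q (p + (j / J : ℝ) • (y - p))).le_opNorm n
        rw [_root_.sub_apply, hn, h0, sub_zero] at h3
        have := norm_pos_iff.2 hn0
        nlinarith
    intro n hn hn0
    refine h J le_rfl n ?_ hn0
    rwa [div_self hJ0.ne', one_smul, add_sub_cancel]
  · have h : ∀ j y v, Q p (transportAux Q p J j y v) = transportAux Q p J j y v := by
      intro j
      induction j with
      | zero => exact fun _ v ↦ hidem p v
      | succ j ih => exact fun y v ↦ ih y _
    exact h J
  · intro y hy
    have h : ∀ j : ℕ, j ≤ J → transportAux Q p J j y = Q p := by
      intro j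
      induction j with
      | zero => exact fun _ ↦ rfl
      | succ j ih =>
        intro hj
        simp only [transportAux]
        rw [ih (by omega), hy _ (hfrac _ hj)]
        ext v
        exact hidem p v
    exact h J le_rfl

end Transport

/-! ### Topological separation of empty balls -/

section NormalVariation

variable {E : Type*} [NormedAddCommGroup E] [InnerProductSpace ℝ E] [FiniteDimensional ℝ E]

theorem IsSmoothSubmanifold.isNearestPoint_of_mem_closedBall {k : ℕ} {S : Set E}
    (hSc : IsCompact S) (hS : IsSmoothSubmanifold k S) {p q n : E} {ρ : ℝ} (hρ : ρ < lfs S p)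
    (hq : q ∈ S) (hqp : q ∈ closedBall p ρ) (hn : n ∈ (tangentDirection S q)ᗮ)
    (hqn : q + n ∈ closedBall p ρ) : IsNearestPoint S (q + n) q := by
  refine hS.isNearestPoint_add hSc hq hn fun s hs hs1 ↦
    notMem_medialAxis_of_mem_closedBall hρ ?_
  have := (convex_closedBall p ρ).add_smul_sub_mem hqp hqn ⟨hs.le, hs1.le⟩
  rwa [add_sub_cancel_left] at this

theorem IsSmoothSubmanifold.nearestPoint_add {k : ℕ} {S : Set E}
    (hSc : IsCompact S) (hS : IsSmoothSubmanifold k S) {p q n : E} {ρ : ℝ} (hρ : ρ < lfs S p)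
    (hq : q ∈ S) (hqp : q ∈ closedBall p ρ) (hn : n ∈ (tangentDirection S q)ᗮ)
    (hqn : q + n ∈ closedBall p ρ) : nearestPoint S (q + n) = q :=
  (isNearestPoint_nearestPoint hSc ⟨q, hq⟩ _).eq_of_notMem_medialAxis
    (hS.isNearestPoint_of_mem_closedBall hSc hρ hq hqp hn hqn)
    (notMem_medialAxis_of_mem_closedBall hρ hqn)

/-- Over a ball that avoids the medial axis, the normal spaces at the nearest points can be mapped
continuously and injectively into the normal space at the center. -/
theorem IsSmoothSubmanifold.exists_normal_transport {k : ℕ} {S : Set E} (hSc : IsCompact S)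
    (hS : IsSmoothSubmanifold k S) {p : E} (hp : p ∈ S) {ρ : ℝ} (hρ0 : 0 ≤ ρ)
    (hρ : ρ < lfs S p) :
    ∃ V : E → E →L[ℝ] E, ContinuousOn V (closedBall p ρ) ∧
      (∀ y v, V y v ∈ (tangentDirection S p)ᗮ) ∧
      (∀ y ∈ closedBall p ρ, ∀ n ∈ (tangentDirection S (nearestPoint S y))ᗮ, V y n = 0 → n = 0) ∧
      ∀ n ∈ (tangentDirection S p)ᗮ, ‖n‖ ≤ ρ → V (p + n) n = n := by
  have hne : S.Nonempty := ⟨p, hp⟩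
  have hπ := isNearestPoint_nearestPoint hSc hne
  set Q : E → E →L[ℝ] E := fun y ↦ (tangentDirection S (nearestPoint S y))ᗮ.starProjection with hQ
  have hidem : ∀ y v, Q y (Q y v) = Q y v := fun y v ↦
    Submodule.starProjection_eq_self_iff.2 (Submodule.starProjection_apply_mem _ _)
  have hpp : nearestPoint S p = p := by
    have := hS.nearestPoint_add hSc hρ hp (mem_closedBall_self hρ0) (Submodule.zero_mem _)
      (by simpa using hρ0)
    rwa [add_zero] at this
  have hQc : ContinuousOn Q (closedBall p ρ) := by
    refine hS.continuousOn_starProjection.comp (f := nearestPoint S) ?_ fun y _ ↦ (hπ y).1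
    exact fun y hy ↦ (continuousAt_nearestPoint hSc hne
      (notMem_medialAxis_of_mem_closedBall hρ hy)).continuousWithinAt
  obtain ⟨V, hVc, hV0, hVp, hVe⟩ := exists_transport hρ0 Q hQc hidem
  refine ⟨V, hVc, fun y v ↦ ?_, fun y hy n hn hVn ↦ ?_, fun n hn hnρ ↦ ?_⟩
  · rw [← hVp y v]
    simp only [hQ, hpp]
    exact Submodule.starProjection_apply_mem _ _
  · by_contra hn0
    exact hV0 y hy n (Submodule.starProjection_eq_self_iff.2 hn) hn0 hVn
  · rw [hVe (p + n)]
    · simp only [hQ, hpp]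
      exact Submodule.starProjection_eq_self_iff.2 hn
    · intro s hs
      simp only [hQ, hpp, add_sub_cancel_left]
      have hmem : p + s • n ∈ closedBall p ρ := by
        rw [mem_closedBall, dist_eq_norm, add_sub_cancel_left, norm_smul,
          Real.norm_of_nonneg hs.1]
        exact (mul_le_of_le_one_left (norm_nonneg _) hs.2).trans hnρ
      rw [hS.nearestPoint_add hSc hρ hp (mem_closedBall_self hρ0) (Submodule.smul_mem _ _ hn) hmem]

/-- A ball that contains no point of `S` and is centered near `p` is disjoint from one of the balls
tangent to `S` at `p`. -/
theorem IsSmoothSubmanifold.exists_disjoint_tangent_ball {k : ℕ} {S : Set E} (hSc : IsCompact S)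
    (hS : IsSmoothSubmanifold k S) {p : E} (hp : p ∈ S) {ρ : ℝ} (hρ0 : 0 < ρ)
    (hρ : ρ < lfs S p) {c : E} (hc : c ∈ closedBall p ρ) {r : ℝ} (hr : 0 < r)
    (hball : ∀ z ∈ S, r ≤ dist c z) :
    ∃ e ∈ (tangentDirection S p)ᗮ, ‖e‖ = ρ ∧ r + ρ ≤ dist c (p + e) := by
  obtain ⟨V, hVc, hVN, hV0, hVe⟩ := hS.exists_normal_transport hSc hp hρ0.le hρ
  have hπ := isNearestPoint_nearestPoint hSc ⟨p, hp⟩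
  have hπc : ContinuousOn (nearestPoint S) (closedBall p ρ) := fun y hy ↦
    (continuousAt_nearestPoint hSc ⟨p, hp⟩
      (notMem_medialAxis_of_mem_closedBall hρ hy)).continuousWithinAt
  -- The cone with apex `c` over the sphere of radius `ρ` in the normal space at `p`, parametrized
  -- by the disc.
  set y : (tangentDirection S p)ᗮ → E := fun x ↦ p + (x + (1 - ‖x‖ / ρ) • (c - p)) with hy
  have hyc : Continuous y := by simp only [hy]; fun_prop
  have hyK : ∀ x ∈ closedBall (0 : (tangentDirection S p)ᗮ) ρ, y x ∈ closedBall p ρ := by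
    intro x hx
    rw [mem_closedBall_zero_iff] at hx
    rw [mem_closedBall, dist_eq_norm] at hc ⊢
    simp only [hy, add_sub_cancel_left]
    have h1 : 0 ≤ 1 - ‖x‖ / ρ := by
      rw [sub_nonneg, div_le_one hρ0]; exact hx
    calc ‖(x : E) + (1 - ‖x‖ / ρ) • (c - p)‖ ≤ ‖x‖ + (1 - ‖x‖ / ρ) * ‖c - p‖ := by
          refine (norm_add_le _ _).trans_eq ?_
          rw [norm_smul, Real.norm_of_nonneg h1, Submodule.coe_norm]
      _ ≤ ‖x‖ + (1 - ‖x‖ / ρ) * ρ := by gcongr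
      _ = ρ := by field_simp; ring
  -- The offset from the nearest point, transported to the normal space at `p`. It is the identity
  -- on the boundary sphere, and transport is injective on normal vectors, so a zero of `g` is a
  -- point of the cone on `S`.
  set g : (tangentDirection S p)ᗮ → (tangentDirection S p)ᗮ := fun x ↦
    ⟨V (y x) (y x - nearestPoint S (y x)), hVN _ _⟩ with hg
  have hgc : ContinuousOn g (closedBall 0 ρ) := by
    rw [Topology.IsInducing.subtypeVal.continuousOn_iff]
    have h1 : ContinuousOn (fun x ↦ V (y x)) (closedBall 0 ρ) :=
      hVc.comp hyc.continuousOn hyK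
    have h2 : ContinuousOn (fun x ↦ nearestPoint S (y x)) (closedBall 0 ρ) :=
      hπc.comp hyc.continuousOn hyK
    exact h1.clm_apply (hyc.continuousOn.sub h2)
  have hgfix : ∀ x ∈ sphere (0 : (tangentDirection S p)ᗮ) ρ, g x = x := by
    intro x hx
    have hxn : ‖x‖ = ρ := mem_sphere_zero_iff_norm.1 hx
    have hyx : y x = p + x := by
      simp only [hy, hxn, div_self hρ0.ne', sub_self, zero_smul, add_zero]
    ext
    simp only [hg]
    have hmem : p + (x : E) ∈ closedBall p ρ := by
      rw [← hyx]; exact hyK x (sphere_subset_closedBall hx)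
    rw [hyx, hS.nearestPoint_add hSc hρ hp (mem_closedBall_self hρ0.le) x.2 hmem,
      add_sub_cancel_left]
    exact hVe x x.2 hxn.le
  obtain ⟨x, hx, hgx⟩ := exists_zero_of_eqOn_sphere hρ0 g hgc hgfix
  have hyS : y x ∈ S := by
    have h1 : V (y x) (y x - nearestPoint S (y x)) = 0 := congrArg Subtype.val hgx
    have h2 := hV0 _ (hyK x hx) _ (hS.sub_mem_orthogonal (hπ (y x))) h1
    rw [sub_eq_zero] at h2
    rw [h2]; exact (hπ _).1
  have hx0 : x ≠ 0 := by
    rintro rfl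
    have h1 : y 0 = c := by simp [hy]
    have h2 := hball _ hyS
    rw [h1, dist_self] at h2
    exact hr.not_ge h2
  have hxpos : 0 < ‖x‖ := norm_pos_iff.2 hx0
  have hxρ : ‖x‖ ≤ ρ := mem_closedBall_zero_iff.1 hx
  have heN : (ρ / ‖x‖) • (x : E) ∈ (tangentDirection S p)ᗮ := Submodule.smul_mem _ _ x.2
  have hen : ‖(ρ / ‖x‖) • (x : E)‖ = ρ := by
    rw [norm_smul, Real.norm_of_nonneg (by positivity)]
    exact div_mul_cancel₀ _ hxpos.ne'
  refine ⟨(ρ / ‖x‖) • (x : E), heN, hen, ?_⟩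
  set e := (ρ / ‖x‖) • (x : E)
  -- The point found on `S` lies between `c` and `p + e` but inside neither open ball, so the
  -- distance of the centers is at least the sum of the radii.
  have hseg : y x ∈ segment ℝ c (p + e) := by
    refine ⟨1 - ‖x‖ / ρ, ‖x‖ / ρ, ?_, by positivity, by ring, ?_⟩
    · rw [sub_nonneg, div_le_one hρ0]; exact hxρ
    · have : (‖x‖ / ρ) • e = x := by
        rw [smul_smul, div_mul_div_cancel₀ hρ0.ne', div_self hxpos.ne', one_smul]
      rw [smul_add, this]
      simp only [hy]
      module
  have hnear := hS.isNearestPoint_of_mem_closedBall hSc hρ hp (mem_closedBall_self hρ0.le) heN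
    (by rw [mem_closedBall, dist_eq_norm, add_sub_cancel_left, hen])
  have h1 := hnear.2 _ hyS
  rw [dist_eq_norm, add_sub_cancel_left, hen, dist_comm] at h1
  have h2 := hball _ hyS
  rw [← dist_add_dist_of_mem_segment hseg]
  linarith

/-- In codimension one, the normal line at a point `q` near `p` can be oriented consistently with
the normal line at `p`, so that empty tangent balls on opposite sides do not overlap. -/
theorem IsSmoothSubmanifold.exists_disjoint_opposite_balls {k : ℕ} {S : Set E}
    (hSc : IsCompact S) (hS : IsSmoothSubmanifold k S) {p q : E} (hp : p ∈ S) (hq : q ∈ S)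
    (hcodim : Module.finrank ℝ (tangentDirection S p)ᗮ = 1) {ρ : ℝ} (hρ0 : 0 < ρ)
    (hρ : ρ < lfs S p) (hqp : q ∈ closedBall p ρ) {n : E} (hn : n ∈ (tangentDirection S q)ᗮ)
    (hn1 : ‖n‖ = 1) {r r' : ℝ} (hr : 0 < r) (hr' : 0 < r') (hc : q + r • n ∈ closedBall p ρ)
    (hc' : q - r' • n ∈ closedBall p ρ) :
    ∃ e ∈ (tangentDirection S p)ᗮ, ‖e‖ = 1 ∧ r + ρ ≤ dist (q + r • n) (p - ρ • e) ∧
      r' + ρ ≤ dist (q - r' • n) (p + ρ • e) := by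
  obtain ⟨V, hVc, hVN, hV0, hVe⟩ := hS.exists_normal_transport hSc hp hρ0.le hρ
  have hπ := isNearestPoint_nearestPoint hSc ⟨p, hp⟩
  have hπc : ContinuousOn (nearestPoint S) (closedBall p ρ) := fun y hy ↦
    (continuousAt_nearestPoint hSc ⟨p, hp⟩
      (notMem_medialAxis_of_mem_closedBall hρ hy)).continuousWithinAt
  have hn0 : n ≠ 0 := by rintro rfl; simp at hn1
  obtain ⟨w, hwN, hw1, hwspan⟩ : ∃ w ∈ (tangentDirection S p)ᗮ, ‖w‖ = 1 ∧
      ∀ v ∈ (tangentDirection S p)ᗮ, inner ℝ w v = 0 → v = 0 := by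
    obtain ⟨w, hw0, hw⟩ := finrank_eq_one_iff'.1 hcodim
    have hw0' : (0 : ℝ) < ‖(w : E)‖ := norm_pos_iff.2 (by simpa using hw0)
    refine ⟨‖(w : E)‖⁻¹ • (w : E), Submodule.smul_mem _ _ w.2, ?_, fun v hv hvw ↦ ?_⟩
    · rw [norm_smul, norm_inv, norm_norm, inv_mul_cancel₀ hw0'.ne']
    · obtain ⟨a, ha⟩ := hw ⟨v, hv⟩
      have ha' : a • (w : E) = v := congrArg Subtype.val ha
      rw [← ha', real_inner_smul_left, real_inner_smul_right, real_inner_self_eq_norm_sq] at hvw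
      have : a = 0 := by
        by_contra ha0
        have := hw0'.ne'
        simp_all
      rw [← ha', this, zero_smul]
  have hchordK : ∀ s ∈ Icc (-r') r, q + s • n ∈ closedBall p ρ := by
    intro s hs
    have hs1 : 0 < r + r' := by linarith
    have h1 := (convex_closedBall p ρ).add_smul_sub_mem hc' hc (t := (s + r') / (r + r'))
      ⟨div_nonneg (by linarith [hs.1]) hs1.le, (div_le_one hs1).2 (by linarith [hs.2])⟩
    have h2 : q - r' • n + ((s + r') / (r + r')) • (q + r • n - (q - r' • n)) = q + s • n := by
      have : q + r • n - (q - r' • n) = (r + r') • n := by module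
      rw [this, smul_smul, div_mul_cancel₀ _ hs1.ne']
      module
    rwa [h2] at h1
  have hchord : ∀ s ∈ Icc (-r') r, nearestPoint S (q + s • n) = q := fun s hs ↦
    hS.nearestPoint_add hSc hρ hq hqp (Submodule.smul_mem _ _ hn) (hchordK s hs)
  -- The transported normal never vanishes along the chord, so its sign against `w` is constant;
  -- this selects the orientation `e = ±w`.
  set h : ℝ → ℝ := fun s ↦ inner ℝ w (V (q + s • n) n)
  have hhc : ContinuousOn h (Icc (-r') r) := by
    have h1 : ContinuousOn (fun s : ℝ ↦ V (q + s • n)) (Icc (-r') r) :=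
      hVc.comp (by fun_prop) hchordK
    exact continuousOn_const.inner (𝕜 := ℝ) (h1.clm_apply continuousOn_const)
  have hh0 : ∀ s ∈ Icc (-r') r, h s ≠ 0 := by
    intro s hs hhs
    have h1 := hwspan _ (hVN _ _) hhs
    exact hn0 (hV0 _ (hchordK s hs) n (by rwa [hchord s hs]) h1)
  obtain ⟨e, heN, he1, hespan, hpos⟩ : ∃ e ∈ (tangentDirection S p)ᗮ, ‖e‖ = 1 ∧
      (∀ v ∈ (tangentDirection S p)ᗮ, inner ℝ e v = 0 → v = 0) ∧
      ∀ s ∈ Icc (-r') r, 0 < inner ℝ e (V (q + s • n) n) := by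
    have hmem : r ∈ Icc (-r') r := ⟨by linarith, le_rfl⟩
    rcases (hh0 r hmem).lt_or_gt with hneg | hpos
    · refine ⟨-w, Submodule.neg_mem _ hwN, by rwa [norm_neg], fun v hv hvw ↦
        hwspan v hv (by rwa [inner_neg_left, neg_eq_zero] at hvw), fun s hs ↦ ?_⟩
      rw [inner_neg_left, neg_pos]
      by_contra! hcon
      obtain ⟨s', hs', hs0⟩ := isPreconnected_Icc.intermediate_value hmem hs hhc
        ⟨hneg.le, hcon⟩
      exact hh0 s' hs' hs0
    · refine ⟨w, hwN, hw1, hwspan, fun s hs ↦ ?_⟩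
      by_contra! hcon
      obtain ⟨s', hs', hs0⟩ := isPreconnected_Icc.intermediate_value hs hmem hhc
        ⟨hcon, hpos.le⟩
      exact hh0 s' hs' hs0
  -- A signed offset that vanishes only on `S`. It equals `t` at `p + t • e` and has the sign of `s`
  -- at `q + s • n`, so segments joining opposite sides cross `S`.
  set f : E → ℝ := fun y ↦ inner ℝ e (V y (y - nearestPoint S y))
  have hfc : ContinuousOn f (closedBall p ρ) :=
    continuousOn_const.inner (𝕜 := ℝ) (hVc.clm_apply (continuousOn_id.sub hπc))
  have hf0 : ∀ y ∈ closedBall p ρ, f y = 0 → y ∈ S := by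
    intro y hy hfy
    have h1 := hespan _ (hVN _ _) hfy
    have h2 := hV0 _ hy _ (hS.sub_mem_orthogonal (hπ y)) h1
    rw [sub_eq_zero] at h2
    rw [h2]; exact (hπ y).1
  have hmeet : ∀ a ∈ closedBall p ρ, ∀ b ∈ closedBall p ρ, f a ≤ 0 → 0 ≤ f b →
      ∃ y ∈ segment ℝ a b, y ∈ S := by
    intro a ha b hb hfa hfb
    have hsub := (convex_closedBall p ρ).segment_subset ha hb
    obtain ⟨y, hy, hfy⟩ := (convex_segment a b).isPreconnected.intermediate_value
      (left_mem_segment ℝ a b) (right_mem_segment ℝ a b) (hfc.mono hsub) ⟨hfa, hfb⟩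
    exact ⟨y, hy, hf0 y (hsub hy) hfy⟩
  have hfp : ∀ t : ℝ, |t| ≤ ρ → p + t • e ∈ closedBall p ρ ∧ f (p + t • e) = t := by
    intro t ht
    have hK : p + t • e ∈ closedBall p ρ := by
      rw [mem_closedBall, dist_eq_norm, add_sub_cancel_left, norm_smul, he1, mul_one]
      exact ht
    have htN : t • e ∈ (tangentDirection S p)ᗮ := Submodule.smul_mem _ _ heN
    refine ⟨hK, ?_⟩
    simp only [f]
    rw [hS.nearestPoint_add hSc hρ hp (mem_closedBall_self hρ0.le) htN hK, add_sub_cancel_left,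
      hVe _ htN (by rw [norm_smul, he1, mul_one]; exact ht), real_inner_smul_right,
      real_inner_self_eq_norm_sq, he1]
    ring
  have hfq : ∀ s ∈ Icc (-r') r, f (q + s • n) = s * inner ℝ e (V (q + s • n) n) := by
    intro s hs
    simp only [f]
    rw [hchord s hs, add_sub_cancel_left, map_smul, real_inner_smul_right]
  have hdistp : ∀ t : ℝ, |t| = ρ → ∀ z ∈ S, ρ ≤ dist (p + t • e) z := by
    intro t ht z hz
    have h1 := (hS.isNearestPoint_of_mem_closedBall hSc hρ hp (mem_closedBall_self hρ0.le)
      (Submodule.smul_mem _ _ heN) (hfp t ht.le).1).2 z hz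
    rwa [dist_eq_norm, add_sub_cancel_left, norm_smul, he1, mul_one, Real.norm_eq_abs, ht] at h1
  have hdistq : ∀ s ∈ Icc (-r') r, ∀ z ∈ S, |s| ≤ dist (q + s • n) z := by
    intro s hs z hz
    have h1 := (hS.isNearestPoint_of_mem_closedBall hSc hρ hq hqp
      (Submodule.smul_mem _ _ hn) (hchordK s hs)).2 z hz
    rwa [dist_eq_norm, add_sub_cancel_left, norm_smul, hn1, mul_one, Real.norm_eq_abs] at h1
  have hrmem : r ∈ Icc (-r') r := ⟨by linarith, le_rfl⟩
  have hrmem' : -r' ∈ Icc (-r') r := ⟨le_rfl, by linarith⟩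
  have habs : |-ρ| = ρ := by rw [abs_neg, abs_of_pos hρ0]
  refine ⟨e, heN, he1, ?_, ?_⟩
  · obtain ⟨y, hy, hyS⟩ := hmeet (p + (-ρ) • e) (hfp _ habs.le).1 (q + r • n) hc
      (by rw [(hfp _ habs.le).2]; linarith)
      (by rw [hfq r hrmem]; exact (mul_pos hr (hpos r hrmem)).le)
    have h1 := hdistp _ habs y hyS
    have h2 := hdistq r hrmem y hyS
    have h3 := dist_add_dist_of_mem_segment hy
    rw [abs_of_pos hr, dist_comm] at h2
    have h4 : p - ρ • e = p + (-ρ) • e := by module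
    rw [h4, dist_comm (q + r • n), ← h3]
    linarith
  · obtain ⟨y, hy, hyS⟩ := hmeet (q + (-r') • n) (hchordK _ hrmem') (p + ρ • e)
      (hfp ρ (abs_of_pos hρ0).le).1
      (by
        rw [hfq _ hrmem']
        have := mul_pos hr' (hpos _ hrmem')
        linarith)
      (by rw [(hfp ρ (abs_of_pos hρ0).le).2]; exact hρ0.le)
    have h1 := hdistp ρ (abs_of_pos hρ0) y hyS
    have h2 := hdistq _ hrmem' y hyS
    have h3 := dist_add_dist_of_mem_segment hy
    rw [abs_neg, abs_of_pos hr'] at h2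
    rw [dist_comm] at h1
    have h4 : q - r' • n = q + (-r') • n := by module
    rw [h4, ← h3]
    linarith

end NormalVariation

/-! ### Real inequalities behind `eta` -/

section Scalars

/-- Here `a`, `a'` are the radii of the two empty balls and `x` the distance of `q` from `p`, in
units of `ρ`. Weighting the inequalities by `a'` and `a` cancels the cross term `g`; the extremal
case is `a = a' = √(1 - x ^ 2)`. -/
theorem one_sub_sq_div_le_of_disjoint_balls {x a a' m g κ : ℝ} (hx : 2 * x ^ 2 ≤ 1) (ha : 0 < a)
    (ha' : 0 < a') (haa : a * a' = 1 - x ^ 2) (hκ : κ ≤ x ^ 4 / 4)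
    (h1 : ((a ^ 2 + 2 * a - 1) / 2) ^ 2 ≤ κ + 2 * a * g + a ^ 2 * m)
    (h2 : ((a' ^ 2 + 2 * a' - 1) / 2) ^ 2 ≤ κ - 2 * a' * g + a' ^ 2 * m) :
    1 - x ^ 2 / √(1 - x ^ 2) ≤ m := by
  have hpos : 0 < 1 - x ^ 2 := by nlinarith
  set w := √(1 - x ^ 2) with hw
  have hw0 : 0 < w := Real.sqrt_pos.2 hpos
  have hw2 : w ^ 2 = 1 - x ^ 2 := Real.sq_sqrt hpos.le
  have hx2 : x ^ 2 = 1 - w ^ 2 := by linarith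
  set σ := a + a' with hσ
  have hσ0 : 0 < σ := by positivity
  have hσw : 2 * w ≤ σ := by
    refine le_of_sq_le_sq ?_ hσ0.le
    nlinarith [sq_nonneg (a - a')]
  have haw : a * a' = w ^ 2 := by rw [haa, hw2]
  have hsum : a' * ((a ^ 2 + 2 * a - 1) / 2) ^ 2 + a * ((a' ^ 2 + 2 * a' - 1) / 2) ^ 2 ≤
      σ * κ + w ^ 2 * σ * m := by
    have e1 := mul_le_mul_of_nonneg_left h1 ha'.le
    have e2 := mul_le_mul_of_nonneg_left h2 ha.le
    have e3 : a' * (κ + 2 * a * g + a ^ 2 * m) + a * (κ - 2 * a' * g + a' ^ 2 * m) =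
        σ * κ + (a * a') * σ * m := by simp only [hσ]; ring
    rw [haw] at e3
    linarith
  have hid : a' * ((a ^ 2 + 2 * a - 1) / 2) ^ 2 + a * ((a' ^ 2 + 2 * a' - 1) / 2) ^ 2 =
      σ * w ^ 2 + w ^ 2 * (σ ^ 2 - 2 * w ^ 2 - 2) +
        σ * (w ^ 2 * (σ ^ 2 - 3 * w ^ 2) - 2 * w ^ 2 + 1) / 4 := by
    rw [← haw]; simp only [hσ]; ring
  -- The slack compared to the extremal case `σ = 2 * w`, nonnegative by the arithmetic-geometric
  -- mean inequality.
  have hfac : 0 ≤ (σ - 2 * w) * (w ^ 2 * σ + w * (w ^ 2 + 1)) :=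
    mul_nonneg (by linarith) (by positivity)
  have hκ' : σ * κ ≤ σ * ((1 - w ^ 2) ^ 2 / 4) := by
    refine mul_le_mul_of_nonneg_left (hκ.trans (le_of_eq ?_)) hσ0.le
    rw [← hx2]; ring
  have hcub : σ * (w ^ 2 * w ^ 2) ≤ σ * (w ^ 2 * (σ ^ 2 - 3 * w ^ 2)) := by
    refine mul_le_mul_of_nonneg_left (mul_le_mul_of_nonneg_left ?_ (by positivity)) hσ0.le
    nlinarith
  have hmain : (σ * w) * (w ^ 2 + w - 1) ≤ (σ * w) * (w * m) := by nlinarith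
  have hfin := le_of_mul_le_mul_left hmain (by positivity)
  rw [hx2, sub_le_iff_le_add, ← sub_le_iff_le_add', le_div_iff₀ hw0]
  linarith

theorem one_sub_sq_div_two_mul_le_of_disjoint_balls {x a a' m : ℝ} (hx : 2 * x ^ 2 ≤ 1)
    (ha : 0 < a) (ha' : 0 < a') (haa : a * a' = 1 - x ^ 2)
    (h : (a + 1) ^ 2 + (a' + 1) ^ 2 ≤ 4 + 2 * (a + a') * m) :
    1 - x ^ 2 / (2 * √(1 - x ^ 2)) ≤ m := by
  have hpos : 0 < 1 - x ^ 2 := by nlinarith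
  set w := √(1 - x ^ 2) with hw
  have hw0 : 0 < w := Real.sqrt_pos.2 hpos
  have hw2 : w ^ 2 = 1 - x ^ 2 := Real.sq_sqrt hpos.le
  have hx2 : x ^ 2 = 1 - w ^ 2 := by linarith
  set σ := a + a' with hσ
  have hσ0 : 0 < σ := by positivity
  have hσw : 2 * w ≤ σ := by
    refine le_of_sq_le_sq ?_ hσ0.le
    nlinarith [sq_nonneg (a - a')]
  have haw : a * a' = w ^ 2 := by rw [haa, hw2]
  have hsq : (a + 1) ^ 2 + (a' + 1) ^ 2 = σ ^ 2 - 2 * w ^ 2 + 2 * σ + 2 := by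
    rw [← haw]; simp only [hσ]; ring
  rw [hsq] at h
  have hfac : 0 ≤ (σ - 2 * w) * (w * σ + 1 + w ^ 2) :=
    mul_nonneg (by linarith) (by positivity)
  have hw' := mul_le_mul_of_nonneg_left h hw0.le
  have hmain : σ * (2 * w - (1 - w ^ 2)) ≤ σ * (2 * w * m) := by nlinarith
  have hfin := le_of_mul_le_mul_left hmain hσ0
  rw [hx2, sub_le_iff_le_add, ← sub_le_iff_le_add', le_div_iff₀ (by positivity)]
  linarith

theorem sq_div_sqrt_one_sub_sq_le {x y : ℝ} (hx : 0 ≤ x) (hxy : x ≤ y) (hy : y < 1) :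
    x ^ 2 / √(1 - x ^ 2) ≤ y ^ 2 / √(1 - y ^ 2) := by
  have h1 : 0 < 1 - y ^ 2 := by nlinarith
  have h2 : 0 < √(1 - y ^ 2) := Real.sqrt_pos.2 h1
  gcongr

theorem eta_mono (c : ℕ) {x y : ℝ} (hx : 0 ≤ x) (hxy : x ≤ y) (hy : y < 1) :
    eta c x ≤ eta c y := by
  have h := sq_div_sqrt_one_sub_sq_le hx hxy hy
  unfold eta eta1 eta2
  split_ifs
  · refine Real.arccos_le_arccos ?_
    rw [mul_comm 2, mul_comm 2, ← div_div, ← div_div]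
    linarith
  · exact Real.arccos_le_arccos (Real.sqrt_le_sqrt (by linarith))

theorem eta_lt_pi_div_two (c : ℕ) {x : ℝ} (hx : 2 * x ^ 2 ≤ 1) : eta c x < Real.pi / 2 := by
  have h0 : (1 / 2 : ℝ) < √(1 - x ^ 2) := by
    apply Real.lt_sqrt_of_sq_lt; nlinarith
  have h1 : x ^ 2 / √(1 - x ^ 2) < 1 := by
    rw [div_lt_one (by linarith)]; linarith
  unfold eta eta1 eta2
  split_ifs
  · rw [Real.arccos_lt_pi_div_two, mul_comm 2, ← div_div]
    linarith
  · rw [Real.arccos_lt_pi_div_two]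
    exact Real.sqrt_pos.2 (by linarith)

end Scalars

/-! ### Quantitative normal variation -/

section NormalVariationBounds

variable {E : Type*} [NormedAddCommGroup E] [InnerProductSpace ℝ E]

/-- A line through an interior point `q` of a ball leaves the ball at two points, and the product
of their distances from `q` is determined by the power of `q`. -/
theorem exists_exit_points {p q n : E} {ρ : ℝ} (hq : ‖q - p‖ < ρ) (hn : ‖n‖ = 1) :
    ∃ r r' : ℝ, 0 < r ∧ 0 < r' ∧ ‖q + r • n - p‖ = ρ ∧ ‖q - r' • n - p‖ = ρ ∧
      r * r' = ρ ^ 2 - ‖q - p‖ ^ 2 := by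
  have hρ : 0 < ρ := (norm_nonneg _).trans_lt hq
  set b := inner ℝ (q - p) n
  have hlt : 0 < ρ ^ 2 - ‖q - p‖ ^ 2 := by nlinarith [norm_nonneg (q - p)]
  set D := √(b ^ 2 + (ρ ^ 2 - ‖q - p‖ ^ 2))
  have hD2 : D ^ 2 = b ^ 2 + (ρ ^ 2 - ‖q - p‖ ^ 2) := Real.sq_sqrt (by positivity)
  have hDb : |b| < D := by
    rw [← Real.sqrt_sq_eq_abs]
    exact Real.sqrt_lt_sqrt (sq_nonneg _) (by linarith)
  have hDb' := abs_lt.1 hDb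
  have hsq : ∀ s : ℝ, ‖(q - p) + s • n‖ ^ 2 = ‖q - p‖ ^ 2 + 2 * s * b + s ^ 2 := by
    intro s
    rw [norm_add_sq_real, real_inner_smul_right, norm_smul, hn, mul_one, Real.norm_eq_abs, sq_abs]
    ring
  -- The line meets the sphere at the roots `-b ± D` of `s ^ 2 + 2 * b * s = ρ ^ 2 - ‖q - p‖ ^ 2`.
  refine ⟨D - b, D + b, by linarith, by linarith, ?_, ?_, by nlinarith⟩
  · have h : q + (D - b) • n - p = (q - p) + (D - b) • n := by abel
    rw [h, ← sq_eq_sq₀ (norm_nonneg _) hρ.le, hsq]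
    nlinarith
  · have h : q - (D + b) • n - p = (q - p) + (-(D + b)) • n := by module
    rw [h, ← sq_eq_sq₀ (norm_nonneg _) hρ.le, hsq]
    nlinarith

variable [FiniteDimensional ℝ E]

theorem norm_starProjection_le_of_inner_le {N : Submodule ℝ E} {v : E} {C : ℝ} (hC : 0 ≤ C)
    (h : ∀ n ∈ N, inner ℝ v n ≤ C * ‖n‖) : ‖N.starProjection v‖ ≤ C := by
  have h1 := h _ (Submodule.starProjection_apply_mem N v)
  have h2 : inner ℝ v (N.starProjection v) = ‖N.starProjection v‖ ^ 2 := by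
    rw [← real_inner_self_eq_norm_sq]
    have := Submodule.starProjection_inner_eq_zero (K := N) v _
      (Submodule.starProjection_apply_mem N v)
    rw [inner_sub_left] at this
    linarith
  rw [h2] at h1
  rcases (norm_nonneg (N.starProjection v)).eq_or_lt with h0 | h0
  · rwa [← h0]
  · nlinarith

theorem inner_eq_inner_starProjection {N : Submodule ℝ E} (v : E) {n : E} (hn : n ∈ N) :
    inner ℝ v n = inner ℝ (N.starProjection v) n := by
  have := Submodule.starProjection_inner_eq_zero (K := N) v n hn
  rw [inner_sub_left] at this
  linarith

/-- Each empty ball about an exit point of the normal line at `q` misses some ball tangent at `p`,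
so the normal part of its center relative to `p` is long. That part is composed of the normal parts
of `q - p`, which is quadratically small, and of `n`. -/
theorem IsSmoothSubmanifold.le_norm_starProjection_aux {k : ℕ} {S : Set E} (hSc : IsCompact S)
    (hS : IsSmoothSubmanifold k S) {p q : E} (hp : p ∈ S) (hq : q ∈ S) {ρ : ℝ} (hρ0 : 0 < ρ)
    (hρ : ρ < lfs S p) (hqp : 2 * ‖q - p‖ ^ 2 ≤ ρ ^ 2) {n : E}
    (hn : n ∈ (tangentDirection S q)ᗮ) (hn1 : ‖n‖ = 1) :
    1 - (‖q - p‖ / ρ) ^ 2 / √(1 - (‖q - p‖ / ρ) ^ 2) ≤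
      ‖(tangentDirection S p)ᗮ.starProjection n‖ ^ 2 := by
  set N := (tangentDirection S p)ᗮ
  have hqρ : ‖q - p‖ < ρ := by nlinarith [norm_nonneg (q - p)]
  have hqK : q ∈ closedBall p ρ := by rw [mem_closedBall, dist_eq_norm]; exact hqρ.le
  obtain ⟨r, r', hr, hr', hc, hc', hrr⟩ := exists_exit_points hqρ hn1
  have hproj : ‖N.starProjection (q - p)‖ ≤ ‖q - p‖ ^ 2 / (2 * ρ) := by
    refine norm_starProjection_le_of_inner_le (by positivity) fun v hv ↦ ?_
    have h := hS.two_mul_lfs_mul_inner_le hSc hp hv hq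
    rw [div_mul_eq_mul_div, le_div_iff₀ (by positivity)]
    rcases le_total (inner ℝ (q - p) v) 0 with h0 | h0
    · exact (mul_nonpos_of_nonpos_of_nonneg h0 (by positivity)).trans (by positivity)
    · nlinarith
  have hcenter : ∀ s : ℝ, s ≠ 0 → ‖q + s • n - p‖ = ρ → |s| ≤ ρ ∧
      (|s| ^ 2 + 2 * |s| * ρ - ρ ^ 2) / 2 ≤
        ρ * ‖N.starProjection (q - p) + s • N.starProjection n‖ := by
    intro s hs hsρ
    have hK : q + s • n ∈ closedBall p ρ := by rw [mem_closedBall, dist_eq_norm, hsρ]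
    have hball : ∀ z ∈ S, |s| ≤ dist (q + s • n) z := by
      intro z hz
      have h := (hS.isNearestPoint_of_mem_closedBall hSc hρ hq hqK
        (Submodule.smul_mem _ _ hn) hK).2 z hz
      rwa [dist_eq_norm, add_sub_cancel_left, norm_smul, hn1, mul_one, Real.norm_eq_abs] at h
    refine ⟨by have := hball p hp; rwa [dist_eq_norm, hsρ] at this, ?_⟩
    obtain ⟨e, he, heρ, hdist⟩ := hS.exists_disjoint_tangent_ball hSc hp hρ0 hρ hK
      (abs_pos.2 hs) hball
    have h1 : q + s • n - (p + e) = (q + s • n - p) - e := by abel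
    have h2 : (|s| + ρ) ^ 2 ≤ ‖(q + s • n - p) - e‖ ^ 2 := by
      rw [← h1, ← dist_eq_norm]
      gcongr
    rw [norm_sub_sq_real, hsρ, heρ, inner_eq_inner_starProjection _ he] at h2
    have h3 : q + s • n - p = (q - p) + s • n := by abel
    rw [h3, map_add, map_smul] at h2
    have h4 := neg_le_of_abs_le (abs_real_inner_le_norm
      (N.starProjection (q - p) + s • N.starProjection n) e)
    rw [heρ] at h4
    nlinarith
  obtain ⟨hrρ, h1⟩ := hcenter r hr.ne' hc
  obtain ⟨hrρ', h2⟩ := hcenter (-r') (by linarith : -r' < 0).ne (by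
    rw [neg_smul, ← sub_eq_add_neg]; exact hc')
  rw [abs_of_pos hr] at hrρ h1
  rw [abs_neg, abs_of_pos hr'] at hrρ' h2
  -- From `r * r' ≥ ρ ^ 2 / 2` and `r' ≤ ρ`. This makes the lower bounds in `h1` and `h2`
  -- nonnegative, so they may be squared.
  have hr2 : ρ / 2 ≤ r := by nlinarith
  have hr2' : ρ / 2 ≤ r' := by nlinarith
  have hA : 0 ≤ r ^ 2 + 2 * r * ρ - ρ ^ 2 := by nlinarith
  have hA' : 0 ≤ r' ^ 2 + 2 * r' * ρ - ρ ^ 2 := by nlinarith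
  have hexp : ∀ s : ℝ, ‖N.starProjection (q - p) + s • N.starProjection n‖ ^ 2 =
      ‖N.starProjection (q - p)‖ ^ 2 +
        2 * s * inner ℝ (N.starProjection (q - p)) (N.starProjection n) +
        s ^ 2 * ‖N.starProjection n‖ ^ 2 := by
    intro s
    rw [norm_add_sq_real, real_inner_smul_right, norm_smul, mul_pow, Real.norm_eq_abs, sq_abs]
    ring
  have hs1 : ((r ^ 2 + 2 * r * ρ - ρ ^ 2) / 2) ^ 2 ≤
      (ρ * ‖N.starProjection (q - p) + r • N.starProjection n‖) ^ 2 :=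
    pow_le_pow_left₀ (by linarith) h1 2
  have hs2 : ((r' ^ 2 + 2 * r' * ρ - ρ ^ 2) / 2) ^ 2 ≤
      (ρ * ‖N.starProjection (q - p) + (-r') • N.starProjection n‖) ^ 2 :=
    pow_le_pow_left₀ (by linarith) h2 2
  rw [mul_pow, hexp] at hs1 hs2
  refine one_sub_sq_div_le_of_disjoint_balls (x := ‖q - p‖ / ρ) (a := r / ρ) (a' := r' / ρ)
    (m := ‖N.starProjection n‖ ^ 2)
    (g := inner ℝ (N.starProjection (q - p)) (N.starProjection n) / ρ)
    (κ := ‖N.starProjection (q - p)‖ ^ 2 / ρ ^ 2) ?_ (by positivity) (by positivity) ?_ ?_ ?_ ?_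
  · rw [div_pow, ← mul_div_assoc, div_le_one (by positivity)]; exact hqp
  · field_simp; linarith
  · have h3 : ‖N.starProjection (q - p)‖ ^ 2 ≤ (‖q - p‖ ^ 2 / (2 * ρ)) ^ 2 := by gcongr
    rw [div_le_iff₀ (by positivity)]
    refine h3.trans (le_of_eq ?_)
    field_simp
    ring
  · have h4 : ((r / ρ) ^ 2 + 2 * (r / ρ) - 1) / 2 = (r ^ 2 + 2 * r * ρ - ρ ^ 2) / 2 / ρ ^ 2 := by
      field_simp
    rw [h4, div_pow, div_le_iff₀ (by positivity)]
    refine hs1.trans (le_of_eq ?_)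
    field_simp
  · have h4 : ((r' / ρ) ^ 2 + 2 * (r' / ρ) - 1) / 2 =
        (r' ^ 2 + 2 * r' * ρ - ρ ^ 2) / 2 / ρ ^ 2 := by
      field_simp
    rw [h4, div_pow, div_le_iff₀ (by positivity)]
    refine hs2.trans (le_of_eq ?_)
    field_simp
    ring

/-- One vector `e` serves both exit points, so adding the two inequalities cancels `q - p` exactly
and leaves `⟪n, e⟫`, with no squaring. -/
theorem IsSmoothSubmanifold.le_norm_starProjection_aux_of_codim_one {k : ℕ} {S : Set E}
    (hSc : IsCompact S) (hS : IsSmoothSubmanifold k S) {p q : E} (hp : p ∈ S) (hq : q ∈ S)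
    (hcodim : Module.finrank ℝ (tangentDirection S p)ᗮ = 1) {ρ : ℝ} (hρ0 : 0 < ρ)
    (hρ : ρ < lfs S p) (hqp : 2 * ‖q - p‖ ^ 2 ≤ ρ ^ 2) {n : E}
    (hn : n ∈ (tangentDirection S q)ᗮ) (hn1 : ‖n‖ = 1) :
    1 - (‖q - p‖ / ρ) ^ 2 / (2 * √(1 - (‖q - p‖ / ρ) ^ 2)) ≤
      ‖(tangentDirection S p)ᗮ.starProjection n‖ := by
  have hqρ : ‖q - p‖ < ρ := by nlinarith [norm_nonneg (q - p)]
  have hqK : q ∈ closedBall p ρ := by rw [mem_closedBall, dist_eq_norm]; exact hqρ.le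
  obtain ⟨r, r', hr, hr', hc, hc', hrr⟩ := exists_exit_points hqρ hn1
  obtain ⟨e, he, he1, h1, h2⟩ := hS.exists_disjoint_opposite_balls hSc hp hq hcodim hρ0 hρ hqK
    hn hn1 hr hr' (by rw [mem_closedBall, dist_eq_norm, hc])
    (by rw [mem_closedBall, dist_eq_norm, hc'])
  have hne : inner ℝ n e ≤ ‖(tangentDirection S p)ᗮ.starProjection n‖ := by
    rw [inner_eq_inner_starProjection n he]
    refine (real_inner_le_norm _ _).trans_eq ?_
    rw [he1, mul_one]
  refine le_trans ?_ hne
  have hs1 : (r + ρ) ^ 2 ≤ ‖(q + r • n - p) + ρ • e‖ ^ 2 := by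
    have : q + r • n - (p - ρ • e) = (q + r • n - p) + ρ • e := by abel
    rw [← this, ← dist_eq_norm]; gcongr
  have hs2 : (r' + ρ) ^ 2 ≤ ‖(q - r' • n - p) - ρ • e‖ ^ 2 := by
    have : q - r' • n - (p + ρ • e) = (q - r' • n - p) - ρ • e := by abel
    rw [← this, ← dist_eq_norm]; gcongr
  rw [norm_add_sq_real, hc, real_inner_smul_right, norm_smul, he1, mul_one,
    Real.norm_of_nonneg hρ0.le] at hs1
  rw [norm_sub_sq_real, hc', real_inner_smul_right, norm_smul, he1, mul_one,
    Real.norm_of_nonneg hρ0.le] at hs2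
  have hin : inner ℝ (q + r • n - p) e - inner ℝ (q - r' • n - p) e =
      (r + r') * inner ℝ n e := by
    rw [← inner_sub_left, ← real_inner_smul_left]
    congr 1
    module
  refine one_sub_sq_div_two_mul_le_of_disjoint_balls (x := ‖q - p‖ / ρ) (a := r / ρ)
    (a' := r' / ρ) ?_ (by positivity) (by positivity) ?_ ?_
  · rw [div_pow, ← mul_div_assoc, div_le_one (by positivity)]; exact hqp
  · field_simp; linarith
  · have h3 : (r + ρ) ^ 2 + (r' + ρ) ^ 2 ≤ 4 * ρ ^ 2 + 2 * ρ * ((r + r') * inner ℝ n e) := by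
      rw [← hin]; linarith
    have h4 : (r / ρ + 1) ^ 2 + (r' / ρ + 1) ^ 2 = ((r + ρ) ^ 2 + (r' + ρ) ^ 2) / ρ ^ 2 := by
      field_simp
    rw [h4, div_le_iff₀ (by positivity)]
    refine h3.trans (le_of_eq ?_)
    field_simp

/-- Passes from radii `ρ < l` to the limit `ρ = l`, since the separation argument needs a closed
ball free of the medial axis. -/
theorem le_of_forall_lt_comp_div {f : ℝ → ℝ} {δ l m : ℝ} (hl : 0 < l)
    (hδl : 2 * δ ^ 2 < l ^ 2) (hf : ContinuousAt f (δ / l))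
    (h : ∀ ρ, 0 < ρ → ρ < l → 2 * δ ^ 2 ≤ ρ ^ 2 → f (δ / ρ) ≤ m) : f (δ / l) ≤ m := by
  have hc : Tendsto (fun ρ ↦ f (δ / ρ)) (𝓝[<] l) (𝓝 (f (δ / l))) := by
    have h1 : ContinuousAt (fun ρ : ℝ ↦ δ / ρ) l := continuousAt_const.div continuousAt_id hl.ne'
    exact (ContinuousAt.comp (f := fun ρ : ℝ ↦ δ / ρ) hf h1).tendsto.mono_left nhdsWithin_le_nhds
  refine le_of_tendsto hc ?_
  have e1 : ∀ᶠ ρ : ℝ in 𝓝 l, 0 < ρ := lt_mem_nhds hl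
  have e2 : ∀ᶠ ρ : ℝ in 𝓝 l, 2 * δ ^ 2 < ρ ^ 2 :=
    (by fun_prop : ContinuousAt (fun ρ : ℝ ↦ ρ ^ 2) l).eventually (lt_mem_nhds hδl)
  filter_upwards [nhdsWithin_le_nhds e1, nhdsWithin_le_nhds e2, self_mem_nhdsWithin]
    with ρ h1 h2 h3
  exact h ρ h1 h3 h2.le

theorem IsSmoothSubmanifold.sqrt_le_norm_starProjection {k : ℕ} {S : Set E} (hSc : IsCompact S)
    (hS : IsSmoothSubmanifold k S) {p q : E} (hp : p ∈ S) (hq : q ∈ S)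
    (hqp : 2 * ‖q - p‖ ^ 2 < lfs S p ^ 2) {n : E}
    (hn : n ∈ (tangentDirection S q)ᗮ) (hn1 : ‖n‖ = 1) :
    √(1 - (‖q - p‖ / lfs S p) ^ 2 / √(1 - (‖q - p‖ / lfs S p) ^ 2)) ≤
      ‖(tangentDirection S p)ᗮ.starProjection n‖ := by
  have hl0 : 0 ≤ lfs S p := infDist_nonneg
  have hl : 0 < lfs S p := hl0.lt_of_ne (by intro h; rw [← h] at hqp; nlinarith)
  refine Real.sqrt_le_iff.2 ⟨norm_nonneg _, ?_⟩
  refine le_of_forall_lt_comp_div (f := fun x ↦ 1 - x ^ 2 / √(1 - x ^ 2)) hl hqp ?_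
    fun ρ h0 h1 h2 ↦ hS.le_norm_starProjection_aux hSc hp hq h0 h1 h2 hn hn1
  have hx : (‖q - p‖ / lfs S p) ^ 2 < 1 := by
    rw [div_pow, div_lt_one (by positivity)]; nlinarith [sq_nonneg ‖q - p‖]
  have : √(1 - (‖q - p‖ / lfs S p) ^ 2) ≠ 0 := (Real.sqrt_pos.2 (by linarith)).ne'
  fun_prop (disch := assumption)

theorem IsSmoothSubmanifold.le_norm_starProjection_of_codim_one {k : ℕ} {S : Set E}
    (hSc : IsCompact S) (hS : IsSmoothSubmanifold k S) {p q : E} (hp : p ∈ S) (hq : q ∈ S)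
    (hcodim : Module.finrank ℝ (tangentDirection S p)ᗮ = 1)
    (hqp : 2 * ‖q - p‖ ^ 2 < lfs S p ^ 2) {n : E}
    (hn : n ∈ (tangentDirection S q)ᗮ) (hn1 : ‖n‖ = 1) :
    1 - (‖q - p‖ / lfs S p) ^ 2 / (2 * √(1 - (‖q - p‖ / lfs S p) ^ 2)) ≤
      ‖(tangentDirection S p)ᗮ.starProjection n‖ := by
  have hl0 : 0 ≤ lfs S p := infDist_nonneg
  have hl : 0 < lfs S p := hl0.lt_of_ne (by intro h; rw [← h] at hqp; nlinarith)
  refine le_of_forall_lt_comp_div (f := fun x ↦ 1 - x ^ 2 / (2 * √(1 - x ^ 2))) hl hqp ?_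
    fun ρ h0 h1 h2 ↦ hS.le_norm_starProjection_aux_of_codim_one hSc hp hq hcodim h0 h1 h2 hn hn1
  have hx : (‖q - p‖ / lfs S p) ^ 2 < 1 := by
    rw [div_pow, div_lt_one (by positivity)]; nlinarith [sq_nonneg ‖q - p‖]
  have : 2 * √(1 - (‖q - p‖ / lfs S p) ^ 2) ≠ 0 :=
    mul_ne_zero two_ne_zero (Real.sqrt_pos.2 (by linarith)).ne'
  fun_prop (disch := assumption)

end NormalVariationBounds

/-! ### Angles between subspaces -/

section Angles

variable {E : Type*} [NormedAddCommGroup E] [InnerProductSpace ℝ E]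

/-- Every nonzero vector of `F` makes an angle of at most `θ` with some nonzero vector of `G`. -/
def AngleLE (F G : Submodule ℝ E) (θ : ℝ) : Prop :=
  ∀ u ∈ F, u ≠ 0 → ∃ v ∈ G, v ≠ 0 ∧ InnerProductGeometry.angle u v ≤ θ

theorem AngleLE.mono {F G : Submodule ℝ E} {θ θ' : ℝ} (h : AngleLE F G θ) (hθ : θ ≤ θ') :
    AngleLE F G θ' := fun u hu hu0 ↦
  let ⟨v, hv, hv0, hle⟩ := h u hu hu0
  ⟨v, hv, hv0, hle.trans hθ⟩

theorem AngleLE.trans {F G H : Submodule ℝ E} {a b : ℝ} (h : AngleLE F G a)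
    (h' : AngleLE G H b) : AngleLE F H (a + b) := by
  intro u hu hu0
  obtain ⟨v, hv, hv0, huv⟩ := h u hu hu0
  obtain ⟨w, hw, hw0, hvw⟩ := h' v hv hv0
  exact ⟨w, hw, hw0, (InnerProductGeometry.angle_le_angle_add_angle u v w).trans
    (add_le_add huv hvw)⟩

theorem angleLE_of_pi_div_two_le {F G : Submodule ℝ E} (hG : G ≠ ⊥) {θ : ℝ}
    (hθ : Real.pi / 2 ≤ θ) : AngleLE F G θ := by
  intro u _ _
  obtain ⟨v, hv, hv0⟩ := Submodule.exists_mem_ne_zero_of_ne_bot hG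
  rcases le_total (InnerProductGeometry.angle u v) (Real.pi / 2) with h | h
  · exact ⟨v, hv, hv0, h.trans hθ⟩
  · refine ⟨-v, G.neg_mem hv, neg_ne_zero.2 hv0, ?_⟩
    rw [InnerProductGeometry.angle_neg_right]
    linarith

theorem lineAngle_nonneg (u v : E) : 0 ≤ lineAngle u v := Real.arccos_nonneg _

theorem lineAngle_le_angle (u v : E) : lineAngle u v ≤ InnerProductGeometry.angle u v :=
  Real.arccos_le_arccos (div_le_div_of_nonneg_right (le_abs_self _) (by positivity))

theorem AngleLE.maxMinAngle_le {F G : Submodule ℝ E} {θ : ℝ} (h : AngleLE F G θ) (hθ : 0 ≤ θ) :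
    maxMinAngle F G ≤ θ := by
  refine Real.iSup_le (fun ⟨u, hu, hu0⟩ ↦ ?_) hθ
  obtain ⟨v, hv, hv0, hle⟩ := h u hu hu0
  refine (ciInf_le ⟨0, ?_⟩ (⟨v, hv, hv0⟩ : {v : E // v ∈ G ∧ v ≠ 0})).trans
    ((lineAngle_le_angle u v).trans hle)
  rintro _ ⟨w, rfl⟩
  exact lineAngle_nonneg _ _

variable [FiniteDimensional ℝ E]

/-- The projection of `u` to `G` is the witness, unless `c = 0`: it may then vanish, but the bound
is a right angle. -/
theorem angleLE_arccos {F G : Submodule ℝ E} (hG : G ≠ ⊥) {c : ℝ} (hc : 0 ≤ c)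
    (h : ∀ u ∈ F, ‖u‖ = 1 → c ≤ ‖G.starProjection u‖) : AngleLE F G (Real.arccos c) := by
  rcases hc.eq_or_lt with rfl | hc0
  · exact angleLE_of_pi_div_two_le hG Real.arccos_zero.ge
  intro u hu hu0
  have hpos : 0 < ‖u‖ := norm_pos_iff.2 hu0
  have h1 := h (‖u‖⁻¹ • u) (F.smul_mem _ hu)
    (by rw [norm_smul, norm_inv, norm_norm, inv_mul_cancel₀ hpos.ne'])
  rw [map_smul, norm_smul, norm_inv, norm_norm, ← div_eq_inv_mul, le_div_iff₀ hpos] at h1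
  have hP : 0 < ‖G.starProjection u‖ := (mul_pos hc0 hpos).trans_le h1
  refine ⟨G.starProjection u, Submodule.starProjection_apply_mem _ _, norm_pos_iff.1 hP, ?_⟩
  rw [InnerProductGeometry.angle]
  refine Real.arccos_le_arccos ?_
  rw [inner_eq_inner_starProjection u (Submodule.starProjection_apply_mem G u),
    real_inner_self_eq_norm_sq, le_div_iff₀ (by positivity)]
  nlinarith

/-- Below a right angle the projection from `F` to `G` is injective, hence onto by equality of
dimensions. Each vector of `G` is thus the projection of some vector of `F`, which makes an angle of
at most `θ` with it. -/
theorem AngleLE.symm {F G : Submodule ℝ E} {θ : ℝ} (h : AngleLE F G θ) (hθ : θ < Real.pi / 2)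
    (hFG : Module.finrank ℝ F = Module.finrank ℝ G) : AngleLE G F θ := by
  have hbound : ∀ u ∈ F, u ≠ 0 →
      0 ≤ θ ∧ Real.cos θ * ‖u‖ ≤ ‖G.starProjection u‖ := by
    intro u hu hu0
    obtain ⟨v, hv, hv0, hle⟩ := h u hu hu0
    have hθ0 : 0 ≤ θ := (InnerProductGeometry.angle_nonneg u v).trans hle
    refine ⟨hθ0, ?_⟩
    have hcos : Real.cos θ ≤ Real.cos (InnerProductGeometry.angle u v) :=
      Real.cos_le_cos_of_nonneg_of_le_pi (InnerProductGeometry.angle_nonneg u v)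
        (by linarith [Real.pi_pos]) hle
    have hvpos : 0 < ‖v‖ := norm_pos_iff.2 hv0
    have h1 := InnerProductGeometry.cos_angle_mul_norm_mul_norm u v
    rw [inner_eq_inner_starProjection u hv] at h1
    have h2 := real_inner_le_norm (G.starProjection u) v
    rw [← h1, ← mul_assoc] at h2
    have h3 := le_of_mul_le_mul_right h2 hvpos
    exact (mul_le_mul_of_nonneg_right hcos (norm_nonneg u)).trans h3
  set T : F →ₗ[ℝ] G := (G.orthogonalProjectionOnto : E →ₗ[ℝ] G).comp F.subtype
  have hT : ∀ u : F, ((T u : G) : E) = G.starProjection u := fun u ↦ rfl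
  have hinj : Function.Injective T := by
    rw [← LinearMap.ker_eq_bot, LinearMap.ker_eq_bot']
    intro u hu
    by_contra hu0
    have hu0' : (u : E) ≠ 0 := by simpa using hu0
    obtain ⟨hθ0, h1⟩ := hbound u u.2 hu0'
    rw [← hT, hu, Submodule.coe_zero, norm_zero] at h1
    have h2 : 0 < Real.cos θ := Real.cos_pos_of_mem_Ioo ⟨by linarith [Real.pi_pos], hθ⟩
    have h3 := norm_pos_iff.2 hu0'
    nlinarith
  have hsurj := (LinearMap.injective_iff_surjective_of_finrank_eq_finrank hFG).1 hinj
  intro g hg hg0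
  obtain ⟨f, hf⟩ := hsurj ⟨g, hg⟩
  have hfg : G.starProjection (f : E) = g := by rw [← hT, hf]
  have hf0 : (f : E) ≠ 0 := by
    intro h0
    rw [h0, map_zero] at hfg
    exact hg0 hfg.symm
  obtain ⟨hθ0, h1⟩ := hbound f f.2 hf0
  refine ⟨f, f.2, hf0, ?_⟩
  have hfpos := norm_pos_iff.2 hf0
  have hgpos := norm_pos_iff.2 hg0
  rw [InnerProductGeometry.angle, ← Real.arccos_cos hθ0 (by linarith [Real.pi_pos])]
  refine Real.arccos_le_arccos ?_
  rw [real_inner_comm, inner_eq_inner_starProjection (f : E) hg, hfg, real_inner_self_eq_norm_sq,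
    le_div_iff₀ (by positivity)]
  rw [hfg] at h1
  nlinarith

/-- The bound may be checked from the flat of lower dimension. -/
theorem flatAngle_le_of_angleLE {F G : AffineSubspace ℝ E} {θ : ℝ} (hθ : 0 ≤ θ)
    (hdim : Module.finrank ℝ G.direction ≤ Module.finrank ℝ F.direction)
    (hG : G.direction ≠ ⊥) (h : AngleLE G.direction F.direction θ) : flatAngle F G ≤ θ := by
  unfold flatAngle
  split_ifs with hFG
  · refine AngleLE.maxMinAngle_le ?_ hθ
    rcases lt_or_ge θ (Real.pi / 2) with hlt | hge
    · exact h.symm hlt (le_antisymm hdim hFG)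
    · exact angleLE_of_pi_div_two_le hG hge
  · exact h.maxMinAngle_le hθ

end Angles

/-! ### Normal variation as an angle bound -/

section NormalVariationAngle

variable {E : Type*} [NormedAddCommGroup E] [InnerProductSpace ℝ E] [FiniteDimensional ℝ E]

/-- The normal spaces of a submanifold at two points `p` and `q` that are close compared to the
local feature size at `p` enclose an angle of at most `eta`. -/
theorem IsSmoothSubmanifold.angleLE_normal {k : ℕ} {S : Set E} (hSc : IsCompact S)
    (hS : IsSmoothSubmanifold k S) (hk : k < Module.finrank ℝ E) {p q : E} (hp : p ∈ S)
    (hq : q ∈ S) {δ : ℝ} (hδ : 2 * δ ^ 2 < 1) (hl : 0 < lfs S p)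
    (hqp : dist q p ≤ δ * lfs S p) :
    AngleLE (tangentDirection S q)ᗮ (tangentDirection S p)ᗮ
      (eta (Module.finrank ℝ E - k) δ) := by
  have hrank := hS.finrank_orthogonal hp
  have hne : (tangentDirection S p)ᗮ ≠ ⊥ := by
    intro h
    rw [h, finrank_bot] at hrank
    omega
  rw [dist_eq_norm] at hqp
  have hx : ‖q - p‖ / lfs S p ≤ δ := by rwa [div_le_iff₀ hl]
  have hx0 : 0 ≤ ‖q - p‖ / lfs S p := by positivity
  have hδ1 : δ < 1 := by nlinarith
  have hlt : 2 * ‖q - p‖ ^ 2 < lfs S p ^ 2 := by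
    have h1 : (‖q - p‖ / lfs S p) ^ 2 ≤ δ ^ 2 := by gcongr
    rw [div_pow, div_le_iff₀ (by positivity)] at h1
    have h2 : 0 < lfs S p ^ 2 := by positivity
    nlinarith
  refine AngleLE.mono ?_ (eta_mono _ hx0 hx hδ1)
  have hx2 : 2 * (‖q - p‖ / lfs S p) ^ 2 ≤ 1 := by
    rw [div_pow, ← mul_div_assoc, div_le_one (by positivity)]; exact hlt.le
  unfold eta
  split_ifs with hc
  · refine angleLE_arccos hne ?_ fun n hn hn1 ↦
      hS.le_norm_starProjection_of_codim_one hSc hp hq (by omega) hlt hn hn1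
    have h := eta_lt_pi_div_two 1 hx2
    rw [eta, if_pos rfl, eta1, Real.arccos_lt_pi_div_two] at h
    exact h.le
  · exact angleLE_arccos hne (Real.sqrt_nonneg _) fun n hn hn1 ↦
      hS.sqrt_le_norm_starProjection hSc hp hq hlt hn hn1

end NormalVariationAngle

/-! ### Normal spaces of inscribed triangles -/

section Triangles

variable {E : Type*} [NormedAddCommGroup E] [InnerProductSpace ℝ E]

theorem vectorSpan_triangle_eq_span_pair (τ : Affine.Triangle ℝ E) {i j m : Fin 3} (hij : i ≠ j)
    (him : i ≠ m) (hjm : j ≠ m) :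
    vectorSpan ℝ (range τ.points) =
      Submodule.span ℝ {τ.points j - τ.points i, τ.points m - τ.points i} := by
  rw [vectorSpan_range_eq_span_range_vsub_right ℝ τ.points i]
  apply le_antisymm
  · rw [Submodule.span_le]
    rintro _ ⟨t, rfl⟩
    have ht : t = i ∨ t = j ∨ t = m := by omega
    rcases ht with rfl | rfl | rfl
    · simp
    · exact Submodule.subset_span (by simp)
    · exact Submodule.subset_span (by simp)
  · rw [Submodule.span_le]
    rintro v (rfl | rfl)
    · exact Submodule.subset_span ⟨j, rfl⟩
    · exact Submodule.subset_span ⟨m, rfl⟩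

theorem direction_simplexNormalSpace {n : ℕ} (τ : Affine.Simplex ℝ E n) {u : E}
    (hu : u ∈ simplexNormalSpace τ) :
    (simplexNormalSpace τ).direction = (vectorSpan ℝ (range τ.points))ᗮ := by
  ext w
  rw [← AffineSubspace.vadd_mem_iff_mem_direction w hu, simplexNormalSpace]
  simp only [AffineSubspace.mem_iInf_iff]
  have key : ∀ i j, w +ᵥ u ∈ AffineSubspace.perpBisector (τ.points i) (τ.points j) ↔
      inner ℝ w (τ.points j - τ.points i) = 0 := by
    intro i j
    have h := (mem_simplexNormalSpace τ u).1 hu i j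
    rw [AffineSubspace.mem_perpBisector_iff_dist_eq, vadd_eq_add, dist_eq_norm, dist_eq_norm,
      ← sq_eq_sq₀ (norm_nonneg _) (norm_nonneg _)]
    rw [dist_eq_norm, dist_eq_norm, ← sq_eq_sq₀ (norm_nonneg _) (norm_nonneg _)] at h
    have e : ∀ t : E, ‖w + u - t‖ ^ 2 = ‖w‖ ^ 2 + 2 * inner ℝ w (u - t) + ‖u - t‖ ^ 2 := by
      intro t; rw [add_sub_assoc, norm_add_sq_real]
    have e' : inner ℝ w (τ.points j - τ.points i) =
        inner ℝ w (u - τ.points i) - inner ℝ w (u - τ.points j) := by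
      rw [← inner_sub_right]; congr 1; abel
    rw [e, e, e']
    constructor <;> intro h' <;> linarith
  simp only [key]
  rw [Submodule.mem_orthogonal']
  constructor
  · intro h v hv
    refine Submodule.span_induction (p := fun v _ ↦ inner ℝ w v = 0) ?_ (inner_zero_right _)
      (fun x y _ _ hx hy ↦ by rw [inner_add_right, hx, hy, add_zero])
      (fun a x _ hx ↦ by rw [inner_smul_right, hx, mul_zero]) hv
    rintro _ ⟨_, ⟨i, rfl⟩, _, ⟨j, rfl⟩, rfl⟩
    exact h j i
  · intro h i j
    exact h _ (vsub_mem_vectorSpan ℝ ⟨j, rfl⟩ ⟨i, rfl⟩)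

variable [FiniteDimensional ℝ E]

/-- Gram determinant formula, kept free of division. -/
theorem norm_sq_starProjection_span_pair_mul (a b v : E) :
    ‖(Submodule.span ℝ {a, b}).starProjection v‖ ^ 2 *
        (‖a‖ ^ 2 * ‖b‖ ^ 2 - inner ℝ a b ^ 2) =
      inner ℝ v a ^ 2 * ‖b‖ ^ 2 - 2 * inner ℝ v a * inner ℝ v b * inner ℝ a b +
        inner ℝ v b ^ 2 * ‖a‖ ^ 2 := by
  have ha : a ∈ Submodule.span ℝ {a, b} := Submodule.subset_span (by simp)
  have hb : b ∈ Submodule.span ℝ {a, b} := Submodule.subset_span (by simp)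
  rw [inner_eq_inner_starProjection v ha, inner_eq_inner_starProjection v hb]
  obtain ⟨α, β, hw⟩ := Submodule.mem_span_pair.1
    (Submodule.starProjection_apply_mem (Submodule.span ℝ {a, b}) v)
  rw [← hw]
  have h1 : inner ℝ (α • a + β • b) a = α * ‖a‖ ^ 2 + β * inner ℝ a b := by
    rw [inner_add_left, real_inner_smul_left, real_inner_smul_left, real_inner_self_eq_norm_sq,
      real_inner_comm]
  have h2 : inner ℝ (α • a + β • b) b = α * inner ℝ a b + β * ‖b‖ ^ 2 := by
    rw [inner_add_left, real_inner_smul_left, real_inner_smul_left, real_inner_self_eq_norm_sq]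
  have h3 : ‖α • a + β • b‖ ^ 2 =
      α * inner ℝ (α • a + β • b) a + β * inner ℝ (α • a + β • b) b := by
    rw [← real_inner_smul_right, ← real_inner_smul_right, ← inner_add_right,
      real_inner_self_eq_norm_sq]
  rw [h3, h1, h2]
  ring

/-- If a unit vector `n` is nearly orthogonal to two sides `a`, `b` of a triangle that is inscribed
in a sphere of radius `s`, then its projection to the plane of the triangle is small, unless the
angle enclosed by the sides is small. -/
theorem mul_norm_starProjection_span_pair_le {a b n w : E} {s l c : ℝ} (hl : 0 < l) (hs : 0 ≤ s)
    (hc0 : 0 ≤ c) (hc1 : c < 1) (hD : inner ℝ a b ^ 2 < ‖a‖ ^ 2 * ‖b‖ ^ 2)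
    (hcos : inner ℝ a b ≤ c * (‖a‖ * ‖b‖)) (hw : ‖w‖ = s) (hwa : 2 * inner ℝ w a = ‖a‖ ^ 2)
    (hwb : 2 * inner ℝ w b = ‖b‖ ^ 2) (hna : 2 * l * |inner ℝ n a| ≤ ‖a‖ ^ 2)
    (hnb : 2 * l * |inner ℝ n b| ≤ ‖b‖ ^ 2) :
    l * ‖(Submodule.span ℝ {a, b}).starProjection n‖ ≤ s * √((1 + c) / (1 - c)) := by
  set D := ‖a‖ ^ 2 * ‖b‖ ^ 2 - inner ℝ a b ^ 2
  have hDpos : 0 < D := by simp only [D]; linarith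
  set g : ℝ := inner ℝ a b
  set A := ‖a‖ ^ 2
  set B := ‖b‖ ^ 2
  have hA : 0 ≤ A := sq_nonneg _
  have hB : 0 ≤ B := sq_nonneg _
  set P := (Submodule.span ℝ {a, b}).starProjection
  set κ := (1 + c) / (1 - c)
  have hc1' : 0 < 1 - c := by linarith
  have hκ : 0 ≤ κ := by positivity
  have e1 : ‖P n‖ ^ 2 * D = inner ℝ n a ^ 2 * B - 2 * inner ℝ n a * inner ℝ n b * g +
      inner ℝ n b ^ 2 * A := norm_sq_starProjection_span_pair_mul a b n
  have e2 : ‖P w‖ ^ 2 * D = inner ℝ w a ^ 2 * B - 2 * inner ℝ w a * inner ℝ w b * g +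
      inner ℝ w b ^ 2 * A := norm_sq_starProjection_span_pair_mul a b w
  have hPw : ‖P w‖ ^ 2 ≤ s ^ 2 := by
    have : ‖P w‖ ≤ ‖w‖ := Submodule.norm_starProjection_apply_le _ _
    rw [hw] at this
    gcongr
  -- The projection of `w` to the plane points to the circumcenter, so this says that the
  -- circumradius is at most `s`.
  have e3 : A * B * (A + B - 2 * g) ≤ 4 * s ^ 2 * D := by
    have hwa' : inner ℝ w a = A / 2 := by linarith
    have hwb' : inner ℝ w b = B / 2 := by linarith
    rw [hwa', hwb'] at e2
    have : 4 * (‖P w‖ ^ 2 * D) ≤ 4 * (s ^ 2 * D) := by gcongr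
    rw [e2] at this
    linarith
  set X := 2 * l * inner ℝ n a with hX
  set Y := 2 * l * inner ℝ n b with hY
  have hXA : |X| ≤ A := by rwa [hX, abs_mul, abs_of_pos (by positivity)]
  have hYB : |Y| ≤ B := by rwa [hY, abs_mul, abs_of_pos (by positivity)]
  have e4 : 4 * l ^ 2 * (‖P n‖ ^ 2 * D) = X ^ 2 * B - 2 * (X * Y * g) + Y ^ 2 * A := by
    rw [e1, hX, hY]; ring
  have e5 : 4 * l ^ 2 * (‖P n‖ ^ 2 * D) ≤ A * B * (A + B + 2 * |g|) := by
    have h1 : X ^ 2 ≤ A ^ 2 := sq_le_sq.2 (by rwa [abs_of_nonneg hA])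
    have h2 : Y ^ 2 ≤ B ^ 2 := sq_le_sq.2 (by rwa [abs_of_nonneg hB])
    have h3 : -(X * Y * g) ≤ A * B * |g| := by
      refine (neg_le_abs _).trans ?_
      rw [abs_mul, abs_mul]
      gcongr
    have h4 : X ^ 2 * B ≤ A ^ 2 * B := by gcongr
    have h5 : Y ^ 2 * A ≤ B ^ 2 * A := by gcongr
    rw [e4]
    linarith
  -- The worst ratio occurs for `‖a‖ = ‖b‖` with cosine exactly `c`.
  have e6 : A + B + 2 * |g| ≤ κ * (A + B - 2 * g) := by
    have hAB : 2 * (‖a‖ * ‖b‖) ≤ A + B := by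
      have := two_mul_le_add_sq ‖a‖ ‖b‖
      linarith
    have hgc : 2 * g ≤ c * (A + B) := by
      have := mul_le_mul_of_nonneg_left hAB hc0
      linarith
    rw [div_mul_eq_mul_div, le_div_iff₀ hc1']
    rcases le_total 0 g with h | h
    · rw [abs_of_nonneg h]; linarith
    · rw [abs_of_nonpos h]
      have : 0 ≤ c * (A + B - 2 * g) := mul_nonneg hc0 (by linarith)
      linarith
  have e7 : 4 * l ^ 2 * (‖P n‖ ^ 2 * D) ≤ κ * (4 * s ^ 2 * D) := by
    refine e5.trans ((mul_le_mul_of_nonneg_left e6 (mul_nonneg hA hB)).trans ?_)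
    calc A * B * (κ * (A + B - 2 * g)) = κ * (A * B * (A + B - 2 * g)) := by ring
      _ ≤ _ := by gcongr
  have e8 : (l * ‖P n‖) ^ 2 ≤ (s * √κ) ^ 2 := by
    rw [mul_pow, mul_pow, Real.sq_sqrt hκ]
    have : (4 * D) * (l ^ 2 * ‖P n‖ ^ 2) ≤ (4 * D) * (s ^ 2 * κ) := by linarith
    exact le_of_mul_le_mul_left this (by positivity)
  exact le_of_sq_le_sq e8 (by positivity)

theorem sqrt_one_add_cos_div_one_sub_cos {φ : ℝ} (h0 : 0 < φ) (h1 : φ < Real.pi) :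
    √((1 + Real.cos φ) / (1 - Real.cos φ)) = Real.cot (φ / 2) := by
  have hs : 0 < Real.sin (φ / 2) := Real.sin_pos_of_pos_of_lt_pi (by linarith) (by linarith)
  have hc : 0 < Real.cos (φ / 2) :=
    Real.cos_pos_of_mem_Ioo ⟨by linarith [Real.pi_pos], by linarith⟩
  have hcos : Real.cos φ = 2 * Real.cos (φ / 2) ^ 2 - 1 := by
    rw [← Real.cos_two_mul]; congr 1; ring
  have hsq := Real.sin_sq_add_cos_sq (φ / 2)
  rw [Real.cot_eq_cos_div_sin, Real.sqrt_eq_iff_mul_self_eq_of_pos (by positivity), hcos]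
  have h2 : 1 - (2 * Real.cos (φ / 2) ^ 2 - 1) = 2 * Real.sin (φ / 2) ^ 2 := by linarith
  rw [h2]
  field_simp
  ring

/-- The normal space of an inscribed triangle and the normal space of the submanifold at a vertex
with plane angle at least `φ` enclose a small angle. -/
theorem IsSmoothSubmanifold.angleLE_triangle {k : ℕ} {S : Set E} (hSc : IsCompact S)
    (hS : IsSmoothSubmanifold k S) (hd : 2 < Module.finrank ℝ E) (τ : Affine.Triangle ℝ E)
    (hτ : ∀ i, τ.points i ∈ S) {u : E} (hu : u ∈ simplexNormalSpace τ) {s : ℝ}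
    (hs : ∀ i, dist (τ.points i) u = s) {i j m : Fin 3} (hij : i ≠ j) (him : i ≠ m) (hjm : j ≠ m)
    (hl : 0 < lfs S (τ.points i)) {δ : ℝ} (hδ : s ≤ δ * lfs S (τ.points i)) {φ : ℝ} (hφ0 : 0 < φ)
    (hφ : φ ≤ Real.pi / 2)
    (hangle : φ ≤ EuclideanGeometry.angle (τ.points j) (τ.points i) (τ.points m)) :
    AngleLE (tangentDirection S (τ.points i))ᗮ (simplexNormalSpace τ).direction
      (Real.arcsin (δ * Real.cot (φ / 2))) := by
  set l := lfs S (τ.points i)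
  have hs0 : 0 ≤ s := by rw [← hs i]; exact dist_nonneg
  have hδ0 : 0 ≤ δ := by
    by_contra! h
    nlinarith
  have hcot : 0 ≤ Real.cot (φ / 2) := by
    rw [← sqrt_one_add_cos_div_one_sub_cos hφ0 (by linarith [Real.pi_pos])]
    exact Real.sqrt_nonneg _
  rw [direction_simplexNormalSpace τ hu]
  have hne : (vectorSpan ℝ (range τ.points))ᗮ ≠ ⊥ := by
    intro h
    have h1 := Submodule.finrank_add_finrank_orthogonal (vectorSpan ℝ (range τ.points))
    rw [h, finrank_bot, τ.independent.finrank_vectorSpan (n := 2) (by simp)] at h1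
    omega
  -- If the argument exceeds `1`, the root is that of a negative number, hence `0`, and both sides
  -- are `π / 2`.
  rw [Real.arcsin_eq_arccos (by positivity)]
  refine angleLE_arccos hne (Real.sqrt_nonneg _) fun n hn hn1 ↦ ?_
  have hnormal : ∀ t, 2 * l * |inner ℝ n (τ.points t - τ.points i)| ≤
      ‖τ.points t - τ.points i‖ ^ 2 := by
    intro t
    have h1 := hS.two_mul_lfs_mul_inner_le hSc (hτ i) hn (hτ t)
    have h2 := hS.two_mul_lfs_mul_inner_le hSc (hτ i) (Submodule.neg_mem _ hn) (hτ t)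
    rw [inner_neg_right, norm_neg] at h2
    rw [hn1, mul_one] at h1 h2
    rw [real_inner_comm] at h1 h2
    rcases abs_cases (inner ℝ n (τ.points t - τ.points i)) with ⟨h, -⟩ | ⟨h, -⟩ <;> rw [h]
    · exact h1
    · exact h2
  have hcenter : ∀ t, 2 * inner ℝ (u - τ.points i) (τ.points t - τ.points i) =
      ‖τ.points t - τ.points i‖ ^ 2 := by
    intro t
    have h1 := (hs t).trans (hs i).symm
    rw [dist_eq_norm, dist_eq_norm, ← sq_eq_sq₀ (norm_nonneg _) (norm_nonneg _),
      ← norm_neg (τ.points i - u), neg_sub] at h1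
    have h2 : τ.points t - u = (τ.points t - τ.points i) - (u - τ.points i) := by abel
    rw [h2, norm_sub_sq_real, real_inner_comm] at h1
    linarith
  set a := τ.points j - τ.points i with ha
  set b := τ.points m - τ.points i with hb
  have hind : LinearIndependent ℝ ![a, b] := by
    have h1 : Module.finrank ℝ (Submodule.span ℝ {a, b}) = 2 := by
      rw [ha, hb, ← vectorSpan_triangle_eq_span_pair τ hij him hjm]
      exact τ.independent.finrank_vectorSpan (n := 2) (by simp)
    rw [linearIndependent_iff_card_eq_finrank_span, Set.finrank]
    rw [Fintype.card_fin, Matrix.range_cons_cons_empty]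
    exact h1.symm
  have hD : inner ℝ a b ^ 2 < ‖a‖ ^ 2 * ‖b‖ ^ 2 := by
    have ha0 : a ≠ 0 := hind.ne_zero 0
    have h1 : |inner ℝ a b| < ‖a‖ * ‖b‖ := by
      refine lt_of_le_of_ne (abs_real_inner_le_norm a b) fun heq ↦ ?_
      have h2 := (norm_inner_eq_norm_iff (𝕜 := ℝ) ha0 (hind.ne_zero 1)).1 heq
      obtain ⟨r, -, hr⟩ := h2
      have h3 := (LinearIndependent.pair_iff.1 hind) r (-1) (by
        have hr' : b = r • a := hr
        rw [hr']; module)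
      norm_num at h3
    rw [← mul_pow, ← sq_abs]
    gcongr
  have hcos : inner ℝ a b ≤ Real.cos φ * (‖a‖ * ‖b‖) := by
    have h1 := InnerProductGeometry.cos_angle_mul_norm_mul_norm a b
    rw [← h1]
    refine mul_le_mul_of_nonneg_right ?_ (by positivity)
    exact Real.cos_le_cos_of_nonneg_of_le_pi hφ0.le (InnerProductGeometry.angle_le_pi _ _) hangle
  have hmain := mul_norm_starProjection_span_pair_le (a := a) (b := b) (n := n)
    (w := u - τ.points i) (s := s) (l := l) (c := Real.cos φ) hl hs0
    (Real.cos_nonneg_of_mem_Icc ⟨by linarith, hφ⟩)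
    (by
      have := Real.cos_lt_cos_of_nonneg_of_le_pi_div_two le_rfl hφ hφ0
      rwa [Real.cos_zero] at this)
    hD hcos (by rw [← hs i, dist_comm, dist_eq_norm]) (hcenter j) (hcenter m) (hnormal j)
    (hnormal m)
  rw [sqrt_one_add_cos_div_one_sub_cos hφ0 (by linarith [Real.pi_pos]), ha, hb,
    ← vectorSpan_triangle_eq_span_pair τ hij him hjm] at hmain
  set W := vectorSpan ℝ (range τ.points)
  have hPn : ‖W.starProjection n‖ ≤ δ * Real.cot (φ / 2) := by
    refine le_of_mul_le_mul_left (hmain.trans ?_) hl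
    calc s * Real.cot (φ / 2) ≤ (δ * l) * Real.cot (φ / 2) := by gcongr
      _ = _ := by ring
  have hpyth := Submodule.norm_sq_eq_add_norm_sq_starProjection n W
  rw [hn1] at hpyth
  refine Real.sqrt_le_iff.2 ⟨norm_nonneg _, ?_⟩
  have : ‖W.starProjection n‖ ^ 2 ≤ (δ * Real.cot (φ / 2)) ^ 2 := by gcongr
  linarith

end Triangles

/-! ### Nearest points of points in the convex hull -/

section NearestPointOfSimplex

variable {E : Type*} [NormedAddCommGroup E] [InnerProductSpace ℝ E]

/-- If all points of a family were closer to `u` than to the nearest point `y` of `x`, then so would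
be every point `x` of their convex hull. -/
theorem IsNearestPoint.exists_dist_le_of_mem_convexHull {S : Set E} {ι : Type*} {v : ι → E}
    {u x y : E} {s : ℝ} (hxy : IsNearestPoint S x y) (hu : u ∈ S)
    (hx : x ∈ convexHull ℝ (range v)) (hs : ∀ i, dist (v i) u = s) : ∃ i, dist y (v i) ≤ s := by
  by_contra! h
  have hlin : ∀ z : E, dist z u < dist z y ↔
      inner ℝ (y - u) z < (‖y‖ ^ 2 - ‖u‖ ^ 2) / 2 := by
    intro z
    rw [dist_eq_norm, dist_eq_norm, ← sq_lt_sq₀ (norm_nonneg _) (norm_nonneg _), norm_sub_sq_real,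
      norm_sub_sq_real, inner_sub_left, real_inner_comm z y, real_inner_comm z u]
    constructor <;> intro h <;> linarith
  have hsub : convexHull ℝ (range v) ⊆ {z | inner ℝ (y - u) z < (‖y‖ ^ 2 - ‖u‖ ^ 2) / 2} := by
    refine convexHull_min ?_ (convex_halfSpace_lt (innerₗ E (y - u)).isLinear _)
    rintro _ ⟨i, rfl⟩
    refine (hlin (v i)).1 ?_
    rw [hs i, dist_comm]
    exact h i
  exact ((hlin x).2 (hsub hx)).not_ge (hxy.2 u hu)

variable [FiniteDimensional ℝ E]

/-- The vertices lie on a sphere about `u` and outside the ball tangent at `y` towards `x`.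
Eliminating the quadratic term between the two conditions gives one affine inequality, which passes
to `x`. As `u` is outside the tangent ball too, `dist y u > s` would contradict `s ≤ lfs y`. -/
theorem IsSmoothSubmanifold.dist_nearest_le_of_mem_convexHull {k : ℕ} {S : Set E}
    (hSc : IsCompact S) (hS : IsSmoothSubmanifold k S) {ι : Type*} {v : ι → E} {u x y : E} {s : ℝ}
    (hv : ∀ i, v i ∈ S) (hu : u ∈ S) (hs : ∀ i, dist (v i) u = s) (hs0 : 0 < s)
    (hsl : 3 * s ≤ lfs S u) (hx : x ∈ convexHull ℝ (range v)) (hxy : IsNearestPoint S x y) :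
    dist y u ≤ s := by
  have hxu : dist x u ≤ s := by
    have : convexHull ℝ (range v) ⊆ closedBall u s := by
      refine convexHull_min ?_ (convex_closedBall u s)
      rintro _ ⟨i, rfl⟩
      exact (hs i).le
    exact this hx
  rcases eq_or_ne x y with rfl | hne
  · exact hxu
  have hxy' := hxy.2 u hu
  have hly : s ≤ lfs S y := by
    have h1 : lfs S u ≤ lfs S y + dist u y := infDist_le_infDist_add_dist
    have h2 := dist_triangle u x y
    rw [dist_comm u x] at h2
    linarith
  set r := lfs S y
  have hr : 0 < r := hs0.trans_le hly
  set h := ‖x - y‖ with hh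
  have hh0 : 0 < h := norm_pos_iff.2 (sub_ne_zero.2 hne)
  have hhs : h ≤ s := by rw [hh, ← dist_eq_norm]; exact hxy'.trans hxu
  have hN := hS.sub_mem_orthogonal hxy
  set q := u - y
  have hlin : ∀ z ∈ convexHull ℝ (range v),
      h * (‖q‖ ^ 2 - s ^ 2) ≤ inner ℝ ((2 * h) • q - (2 * r) • (x - y)) (z - y) := by
    have hconv : Convex ℝ {z | h * (‖q‖ ^ 2 - s ^ 2) +
        inner ℝ ((2 * h) • q - (2 * r) • (x - y)) y ≤
        inner ℝ ((2 * h) • q - (2 * r) • (x - y)) z} :=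
      convex_halfSpace_ge (innerₗ E ((2 * h) • q - (2 * r) • (x - y))).isLinear _
    intro z hz
    rw [inner_sub_right]
    have := convexHull_min (s := range v) ?_ hconv hz
    · have this' : h * (‖q‖ ^ 2 - s ^ 2) + inner ℝ ((2 * h) • q - (2 * r) • (x - y)) y ≤
        inner ℝ ((2 * h) • q - (2 * r) • (x - y)) z := this
      linarith
    · rintro _ ⟨i, rfl⟩
      change h * (‖q‖ ^ 2 - s ^ 2) + inner ℝ ((2 * h) • q - (2 * r) • (x - y)) y ≤
        inner ℝ ((2 * h) • q - (2 * r) • (x - y)) (v i)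
      rw [← le_sub_iff_add_le, ← inner_sub_right]
      have h1 := hS.two_mul_lfs_mul_inner_le hSc hxy.1 hN (hv i)
      have h2 := hs i
      have h3 : v i - u = (v i - y) - q := by simp only [q]; abel
      rw [dist_eq_norm, h3] at h2
      have h4 : ‖v i - y - q‖ ^ 2 = s ^ 2 := by rw [h2]
      rw [norm_sub_sq_real] at h4
      rw [inner_sub_left, real_inner_smul_left, real_inner_smul_left, real_inner_comm,
        real_inner_comm (v i - y) (x - y)]
      nlinarith
  have hx1 := hlin x hx
  rw [inner_sub_left, real_inner_smul_left, real_inner_smul_left, real_inner_self_eq_norm_sq,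
    ← hh] at hx1
  have hu1 := hS.two_mul_lfs_mul_inner_le hSc hxy.1 hN hu
  change 2 * r * inner ℝ q (x - y) ≤ ‖q‖ ^ 2 * h at hu1
  rw [dist_comm, dist_eq_norm]
  change ‖q‖ ≤ s
  refine le_of_sq_le_sq ?_ hs0.le
  have e1 : h * (r * (‖q‖ ^ 2 - s ^ 2)) ≤ h * (h * ‖q‖ ^ 2 - 2 * r ^ 2 * h) := by nlinarith
  have e2 := le_of_mul_le_mul_left e1 hh0
  by_contra! hlt
  have e3 : (r - h) * s ^ 2 ≤ (r - h) * ‖q‖ ^ 2 :=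
    mul_le_mul_of_nonneg_left hlt.le (by linarith)
  have e4 : s ^ 2 ≤ r ^ 2 := by gcongr
  have e5 : h * s ^ 2 ≤ h * r ^ 2 := by gcongr
  have e6 : 0 < h * r ^ 2 := by positivity
  nlinarith

end NearestPointOfSimplex

theorem lfs_le_lfs_add_dist {E : Type*} [NormedAddCommGroup E] (S : Set E) (p q : E) :
    lfs S p ≤ lfs S q + dist p q := infDist_le_infDist_add_dist

end SurfaceApprox

/-! ### The angle bound -/

theorem lemma12 (d k : ℕ) (hk : 2 ≤ k) (hkd : k < d)
    (S : Set (EuclideanSpace ℝ (Fin d)))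
    (hS_compact : IsCompact S) (hS : SurfaceApprox.IsSmoothSubmanifold k S)
    (τ : Affine.Triangle ℝ (EuclideanSpace ℝ (Fin d))) (hτ : ∀ i, τ.points i ∈ S)
    (u : EuclideanSpace ℝ (Fin d)) (huS : u ∈ S)
    (huN : u ∈ SurfaceApprox.simplexNormalSpace τ)
    (s : ℝ) (hs : ∀ i, dist (τ.points i) u = s)
    (ε : ℝ) (hε : ε ≤ 1 / 3) (hsε : s ≤ ε * SurfaceApprox.lfs S u)
    (x : EuclideanSpace ℝ (Fin d)) (hx : x ∈ convexHull ℝ (Set.range τ.points))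
    (x' : EuclideanSpace ℝ (Fin d)) (hx' : SurfaceApprox.IsNearestPoint S x x')
    (φ : ℝ) (hφ_pos : 0 < φ) (hφ_le : φ ≤ Real.pi / 3) :
    SurfaceApprox.flatAngle (SurfaceApprox.simplexNormalSpace τ)
        (SurfaceApprox.normalSpace S x') ≤
      max
        (SurfaceApprox.eta (d - k) (ε / (1 - ε)) +
          Real.arcsin (ε / (1 - ε) * Real.cot (φ / 2)))
        (2 * SurfaceApprox.eta (d - k) ε +
          Real.arcsin (ε / (1 - ε) * Real.cot (Real.pi / 4 - φ / 4))) := by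
  have hπ := Real.pi_pos
  have hfr : Module.finrank ℝ (EuclideanSpace ℝ (Fin d)) = d := by simp
  have hs0 : 0 < s := by
    have hsn : 0 ≤ s := by rw [← hs 0]; exact dist_nonneg
    refine hsn.lt_of_ne fun h ↦ ?_
    have h01 : τ.points 0 = τ.points 1 := by
      rw [dist_eq_zero.1 ((hs 0).trans h.symm), dist_eq_zero.1 ((hs 1).trans h.symm)]
    exact absurd (τ.independent.injective h01) (by decide)
  have hl0 : 0 ≤ SurfaceApprox.lfs S u := Metric.infDist_nonneg
  -- This also excludes the default value `0` of the distance to an empty medial axis.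
  have hlu : 0 < SurfaceApprox.lfs S u := by
    refine hl0.lt_of_ne fun h ↦ ?_
    rw [← h, mul_zero] at hsε
    exact hsε.not_gt hs0
  have hε0 : 0 < ε := by
    by_contra! h
    nlinarith
  have h3s : 3 * s ≤ SurfaceApprox.lfs S u := by nlinarith
  set δ := ε / (1 - ε) with hδ
  have h1ε : 0 < 1 - ε := by linarith
  have hδ0 : 0 < δ := by positivity
  have hδ2 : δ ≤ 1 / 2 := by rw [hδ, div_le_iff₀ h1ε]; linarith
  have hlv : ∀ i, 0 < SurfaceApprox.lfs S (τ.points i) ∧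
      s ≤ δ * SurfaceApprox.lfs S (τ.points i) := by
    intro i
    have h1 := SurfaceApprox.lfs_le_lfs_add_dist S u (τ.points i)
    rw [dist_comm, hs i] at h1
    refine ⟨by linarith, ?_⟩
    rw [hδ, div_mul_eq_mul_div, le_div_iff₀ h1ε]
    nlinarith
  have hangles : ∀ i j m : Fin 3, i ≠ j → i ≠ m → j ≠ m → ∀ ψ, 0 < ψ → ψ ≤ Real.pi / 2 →
      ψ ≤ EuclideanGeometry.angle (τ.points j) (τ.points i) (τ.points m) →
      SurfaceApprox.AngleLE (SurfaceApprox.tangentDirection S (τ.points i))ᗮ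
        (SurfaceApprox.simplexNormalSpace τ).direction (Real.arcsin (δ * Real.cot (ψ / 2))) :=
    fun i j m hij him hjm ψ h0 h1 h2 ↦ hS.angleLE_triangle hS_compact (by omega) τ hτ huN hs hij
      him hjm (hlv i).1 (hlv i).2 h0 h1 h2
  have hdim : Module.finrank ℝ (SurfaceApprox.normalSpace S x').direction = d - k := by
    rw [SurfaceApprox.normalSpace, AffineSubspace.direction_mk']
    have := hS.finrank_orthogonal hx'.1
    omega
  have hdimτ : Module.finrank ℝ (SurfaceApprox.simplexNormalSpace τ).direction = d - 2 := by
    rw [SurfaceApprox.direction_simplexNormalSpace τ huN]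
    have h1 := Submodule.finrank_add_finrank_orthogonal (vectorSpan ℝ (Set.range τ.points))
    rw [τ.independent.finrank_vectorSpan (n := 2) (by simp)] at h1
    omega
  have harcsin : 0 ≤ Real.arcsin (δ * Real.cot (φ / 2)) := by
    refine Real.arcsin_nonneg.2 (mul_nonneg hδ0.le ?_)
    rw [← SurfaceApprox.sqrt_one_add_cos_div_one_sub_cos hφ_pos (by linarith)]
    exact Real.sqrt_nonneg _
  have heta : 0 ≤ SurfaceApprox.eta (d - k) δ := by
    unfold SurfaceApprox.eta
    split_ifs
    · exact Real.arccos_nonneg _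
    · exact Real.arccos_nonneg _
  refine SurfaceApprox.flatAngle_le_of_angleLE
    ((add_nonneg heta harcsin).trans (le_max_left _ _)) (by omega) ?_ ?_
  · intro h
    rw [h, finrank_bot] at hdim
    omega
  rw [SurfaceApprox.normalSpace, AffineSubspace.direction_mk']
  obtain ⟨i, hi⟩ := hx'.exists_dist_le_of_mem_convexHull huS hx hs
  obtain ⟨j, m, hij, him, hjm⟩ : ∃ j m : Fin 3, i ≠ j ∧ i ≠ m ∧ j ≠ m := by
    clear hi; revert i; decide
  rcases le_or_gt φ (EuclideanGeometry.angle (τ.points j) (τ.points i) (τ.points m)) with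
    hge | hlt
  · refine SurfaceApprox.AngleLE.mono ?_ (le_max_left _ _)
    have h1 := hS.angleLE_normal hS_compact (by omega) (hτ i) hx'.1 (δ := δ) (by nlinarith)
      (hlv i).1 (hi.trans (hlv i).2)
    rw [hfr] at h1
    exact h1.trans (hangles i j m hij him hjm φ hφ_pos (by linarith) hge)
  · refine SurfaceApprox.AngleLE.mono ?_ (le_max_right _ _)
    have hxu := hS.dist_nearest_le_of_mem_convexHull hS_compact hτ huS hs hs0 h3s hx hx'
    have h1 := hS.angleLE_normal hS_compact (by omega) huS hx'.1 (δ := ε) (by nlinarith)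
      hlu (hxu.trans hsε)
    have h2 : ∀ t, SurfaceApprox.AngleLE (SurfaceApprox.tangentDirection S u)ᗮ
        (SurfaceApprox.tangentDirection S (τ.points t))ᗮ (SurfaceApprox.eta (d - k) ε) := by
      intro t
      have h3 := hS.angleLE_normal hS_compact (by omega) huS (hτ t) (δ := ε) (by nlinarith)
        hlu ((hs t).le.trans hsε)
      rw [hfr] at h3
      -- The variation bound is relative to the feature size at `u`, so it first leads from the
      -- vertex to `u`; equal dimensions allow the reversal.
      refine h3.symm (SurfaceApprox.eta_lt_pi_div_two _ (by nlinarith)) ?_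
      have e1 := hS.finrank_orthogonal huS
      have e2 := hS.finrank_orthogonal (hτ t)
      omega
    rw [hfr] at h1
    have hcotarg : Real.pi / 4 - φ / 4 = (Real.pi / 2 - φ / 2) / 2 := by ring
    rw [hcotarg, two_mul]
    -- The angles at the other two vertices sum to more than `π - φ`, so one of them is at least `π
    -- / 2 - φ / 2`.
    have hsum := EuclideanGeometry.angle_add_angle_add_angle_eq_pi (τ.points m)
      (p₁ := τ.points j) (τ.independent.injective.ne hij)
    rcases le_or_gt (Real.pi / 2 - φ / 2)
      (EuclideanGeometry.angle (τ.points i) (τ.points j) (τ.points m)) with hj | hj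
    · exact (h1.trans (h2 j)).trans (hangles j i m hij.symm hjm him _ (by linarith) (by linarith) hj)
    · refine (h1.trans (h2 m)).trans (hangles m i j him.symm hjm.symm hij _ (by linarith)
        (by linarith) ?_)
      rw [EuclideanGeometry.angle_comm (τ.points m)] at hsum
      linarith
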